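/- Let $k$ be a number field, and let $X$ and $Y$ be proper smooth geometrically integral $k$-varieties, with projections $p_1:X\times Y\to X$ and $p_2:X\times Y\to Y$ (the product is over $k$). For a variety $V$ over a field write $\mathrm{CH}_0(V)$ for the Chow group of 0-cycles (the free abelian group $\mathrm{Z}_0(V)$ on the closed points modulo rational equivalence), for an abelian group $A$ write $A/n$ for $A/nA$, and for a place $v$ of $k$ write $k_v$ for the completion of $k$ at $v$ and $V_{k_v}$ for the base change of a $k$-variety $V$; 0-cycles on $V$ are pulled back to $V_{k_v}$ without change of notation. Let $S$ be a finite set of places of $k$ and let $n$ be a positive integer. Let $x\in\mathrm{CH}_0(X)$ and $y\in\mathrm{CH}_0(Y)$ be classes of 0-cycles, and for each $v\in S$ let $z_v\in\mathrm{CH}_0((X\times Y)_{k_v})$ be the class of a 0-cycle of degree $1$. Suppose that for all $v\in S$: - $x$ and $p_{1*}(z_v)$ have the same image in $\mathrm{CH}_0(X_{k_v})/n$; - $y$ and $p_{2*}(z_v)$ have the same image in $\mathrm{CH}_0(Y_{k_v})/n$; - $z_v$ is the class of a $k_v$-rational point of $X\times Y$. Let $p_1^*(x)\cap p_2^*(y)\in\mathrm{CH}_0(X\times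 Y)$ be the intersection product of the flat pullbacks of $x$ and $y$. (For any 0-cycles $\xi$ and $\eta$ that represent $x$ and $y$, the cycles $p_1^*\xi$ and $p_2^*\eta$ meet properly, and the product is the class of their intersection cycle, formed with Serre's intersection multiplicities.) Then $p_1^*(x)\cap p_2^*(y)$ and $z_v$ have the same image in $\mathrm{CH}_0((X\times Y)_{k_v})/n$ for all $v\in S$. -/

import Mathlib

universe u

open CategoryTheory CategoryTheory.Limits AlgebraicGeometry

noncomputable section

namespace ZeroCycles

/-! ### Places of a number field and their completions -/

/-- The places of a number field: a finite place is a nonzero prime of the ring of integers,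
an infinite place is a real embedding or a pair of conjugate complex embeddings. -/
abbrev Place (k : Type u) [Field k] [NumberField k] : Type u :=
  IsDedekindDomain.HeightOneSpectrum (NumberField.RingOfIntegers k) ⊕ NumberField.InfinitePlace k

/-- The completion `k_v` of a number field `k` at a place `v`. -/
def Place.Completion {k : Type u} [Field k] [NumberField k] : Place k → Type u
  | .inl v => v.adicCompletion k
  | .inr v => NumberField.InfinitePlace.Completion v

instance {k : Type u} [Field k] [NumberField k] : (v : Place k) → Field v.Completion
  | .inl v => inferInstanceAs (Field (v.adicCompletion k))
  | .inr v => inferInstanceAs (Field (NumberField.InfinitePlace.Completion v))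

instance {k : Type u} [Field k] [NumberField k] : (v : Place k) → Algebra k v.Completion
  | .inl v => inferInstanceAs (Algebra k (v.adicCompletion k))
  | .inr v => inferInstanceAs (Algebra k (NumberField.InfinitePlace.Completion v))

/-! ### Cycles -/

/-- The group `Z_0(V)` of 0-cycles: the free abelian group on the closed points of `V`. -/
abbrev Z0 (V : Scheme.{u}) : Type u := closedPoints V →₀ ℤ

/-- The group of algebraic cycles of all dimensions: the free abelian group on the integral closed
subschemes of `V`, each of which is recorded by its generic point. -/
abbrev Cycle (V : Scheme.{u}) : Type u := V →₀ ℤ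

/-- The part of dimension zero of a cycle. -/
def Cycle.zeroDim {V : Scheme.{u}} (a : Cycle V) : Z0 V :=
  a.subtypeDomain (· ∈ closedPoints V)

/-- The image of a closed point under a proper morphism is a closed point. -/
def imageClosedPoint {V W : Scheme.{u}} (f : V ⟶ W) [IsProper f] (P : closedPoints V) :
    closedPoints W :=
  ⟨f P.1, by
    have h := f.isClosedMap _ (mem_closedPoints_iff.1 P.2)
    rwa [Set.image_singleton] at h⟩

/-- Proper pushforward of 0-cycles: `f_* P = [κ(P) : κ(f P)] f(P)`. -/
def pushforward {V W : Scheme.{u}} (f : V ⟶ W) [IsProper f] : Z0 V →+ Z0 W :=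
  Finsupp.liftAddHom fun P =>
    zmultiplesHom (Z0 W) (Finsupp.single (imageClosedPoint f P) (f.residueDegree P.1 : ℤ))

/-- The degree `∑ n_P [κ(P) : k]` of a 0-cycle `∑ n_P P` on a scheme `V` over `Spec k`. -/
def degree {k : Type u} [Field k] {V : Scheme.{u}} (s : V ⟶ Spec (.of k)) (a : Z0 V) : ℤ :=
  a.sum fun P m => m * (s.residueDegree P.1 : ℤ)

/-- The generic points of the irreducible components of a closed subset `Z`: the points of `Z`
without proper generizations in `Z`. -/
def genericPts {V : Scheme.{u}} (Z : Set V) : Set V :=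
  {z | z ∈ Z ∧ ∀ w ∈ Z, w ⤳ z → w = z}

/-! ### Rational equivalence of 0-cycles -/

/-- The divisor `∑ ord_P(g) P` of a rational function on an integral curve. -/
def divisor (C : Scheme.{u}) [IsIntegral C] [IsLocallyNoetherian C] (g : C.functionField) : Z0 C :=
  ∑ᶠ P : closedPoints C, Finsupp.single P (C.ord g P.1)

/-- The subgroup of 0-cycles rationally equivalent to zero on a variety `V`. It is generated by the
cycles `f_* div(g)`, where `f : C ⟶ V` is a proper morphism from a normal integral curve `C`
(for example the normalization of a closed integral curve in `V`) and `g` is a nonzero rational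
function on `C`. An integral scheme of finite type over a field is a normal curve
exactly when its local rings at closed points are discrete valuation rings, and it is automatically
locally Noetherian. -/
def rationallyTrivial (V : Scheme.{u}) : AddSubgroup (Z0 V) :=
  AddSubgroup.closure
    {a | ∃ (C : Scheme.{u}) (_ : IsIntegral C) (_ : IsLocallyNoetherian C)
        (f : C ⟶ V) (_ : IsProper f) (g : C.functionField),
        (∀ P ∈ closedPoints C, IsDiscreteValuationRing (C.presheaf.stalk P)) ∧ g ≠ 0 ∧
        a = pushforward f (divisor C g)}

/-- The Chow group `CH_0(V)` of 0-cycles modulo rational equivalence. -/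
abbrev CH0 (V : Scheme.{u}) : Type u := Z0 V ⧸ rationallyTrivial V

/-- `A / n`, the cokernel of multiplication by `n` on an abelian group `A`. -/
abbrev ModN (A : Type u) [AddCommGroup A] (n : ℕ) : Type u := A ⧸ (nsmulAddMonoidHom (α := A) n).range

/-- The image in `CH_0(V) / n` of the class of a 0-cycle. -/
def classMod {V : Scheme.{u}} (n : ℕ) (a : Z0 V) : ModN (CH0 V) n :=
  QuotientAddGroup.mk (QuotientAddGroup.mk a : CH0 V)

/-! ### Flat pullback -/

/-- The cycle of the scheme-theoretic fibre `q⁻¹(P)` over a closed point `P`: the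
generic point `Q` of an irreducible component of the fibre is counted with multiplicity the length
of the local ring `𝒪_{W,Q} / 𝔪_P 𝒪_{W,Q}` of the fibre at `Q`. -/
def fibreCycle {W V : Scheme.{u}} (q : W ⟶ V) (P : V) : Cycle W :=
  ∑ᶠ Q ∈ genericPts (q ⁻¹' {P}), Finsupp.single Q
    ((Module.length (W.presheaf.stalk Q) (W.presheaf.stalk Q ⧸
      (IsLocalRing.maximalIdeal (V.presheaf.stalk (q Q))).map (q.stalkMap Q).hom)).toNat : ℤ)

/-- Flat pullback of 0-cycles, `P ↦ [q⁻¹(P)]` (for `q` a flat morphism). -/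
def flatPullback {W V : Scheme.{u}} (q : W ⟶ V) : Z0 V →+ Cycle W :=
  Finsupp.liftAddHom fun P => zmultiplesHom (Cycle W) (fibreCycle q P.1)

/-! ### Intersection of cycles on a smooth variety -/

/-- If `s` specializes to `z`, the prime ideal of `𝒪_{V,z}` that defines the closure of `s`. -/
def primeOf {V : Scheme.{u}} {s z : V} (h : s ⤳ z) : Ideal (V.presheaf.stalk z) :=
  (IsLocalRing.maximalIdeal (V.presheaf.stalk s)).comap (V.presheaf.stalkSpecializes h).hom

/-- The (Serre) intersection multiplicity at `z` of the subvarieties with generic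
points `s` and `t`: the sum over `i` of `(-1)^i length Tor_i(𝒪_z / 𝔭_s, 𝒪_z / 𝔭_t)`,
with `Tor` and length over the local ring `𝒪_z`. -/
def intersectionMult {V : Scheme.{u}} {s t z : V} (hs : s ⤳ z) (ht : t ⤳ z) : ℤ :=
  ∑ᶠ i : ℕ, (-1) ^ i * ((Module.length (V.presheaf.stalk z)
    (((Tor (ModuleCat.{u} (V.presheaf.stalk z)) i).obj
      (ModuleCat.of (V.presheaf.stalk z) (V.presheaf.stalk z ⧸ primeOf hs))).obj
      (ModuleCat.of (V.presheaf.stalk z) (V.presheaf.stalk z ⧸ primeOf ht)))).toNat : ℤ)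

/-- Two cycles meet properly: every irreducible component of the intersection of a component
of `a` with a component of `b` has codimension the sum of their codimensions. (The codimension of
the closure of a point is the coheight of the point for the specialization order.) -/
def MeetProperly {V : Scheme.{u}} (a b : Cycle V) : Prop :=
  ∀ s ∈ a.support, ∀ t ∈ b.support, ∀ z ∈ genericPts (closure {s} ∩ closure {t}),
    Order.coheight z = Order.coheight s + Order.coheight t

/-- The intersection cycle of the subvarieties with generic points `s` and `t`. -/
def intersectPts {V : Scheme.{u}} (s t : V) : Cycle V :=
  ∑ᶠ z : genericPts (closure {s} ∩ closure {t}), Finsupp.single z.1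
    (intersectionMult (specializes_iff_mem_closure.2 z.2.1.1)
      (specializes_iff_mem_closure.2 z.2.1.2))

/-- The intersection product `a ∩ b` of two cycles that meet properly on a smooth variety; its
class is the intersection product of the classes of `a` and `b`. -/
def intersect {V : Scheme.{u}} (a b : Cycle V) : Cycle V :=
  a.sum fun s m => b.sum fun t n => (m * n) • intersectPts s t

/-! ### Products and extension of the base field -/

section BaseChange

variable {k : Type u} [Field k] (K : Type u) [Field K] [Algebra k K]

/-- The base change `V_K = V ×_k K` of a `k`-scheme `V`. -/
abbrev ext {V : Scheme.{u}} (s : V ⟶ Spec (.of k)) : Scheme.{u} :=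
  pullback s (Spec.map (CommRingCat.ofHom (algebraMap k K)))

/-- The structure morphism of `V_K` over `K`. -/
abbrev extStr {V : Scheme.{u}} (s : V ⟶ Spec (.of k)) : ext K s ⟶ Spec (.of K) :=
  pullback.snd s (Spec.map (CommRingCat.ofHom (algebraMap k K)))

/-- The base change `f_K : V_K ⟶ W_K` of a `k`-morphism `f : V ⟶ W`. -/
abbrev extMap {V W : Scheme.{u}} (s : V ⟶ Spec (.of k)) (t : W ⟶ Spec (.of k)) (f : V ⟶ W)
    (h : f ≫ t = s) : ext K s ⟶ ext K t :=
  pullback.map s (Spec.map (CommRingCat.ofHom (algebraMap k K))) t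
    (Spec.map (CommRingCat.ofHom (algebraMap k K))) f (𝟙 _) (𝟙 _) (by simp [h]) (by simp)

instance {V W : Scheme.{u}} (s : V ⟶ Spec (.of k)) (t : W ⟶ Spec (.of k)) (f : V ⟶ W)
    (h : f ≫ t = s) [IsProper f] : IsProper (extMap K s t f h) := by
  subst h
  refine MorphismProperty.of_isPullback (P := @IsProper)
    (f' := pullback.fst (f ≫ t) (Spec.map (CommRingCat.ofHom (algebraMap k K))))
    (f := pullback.fst t (Spec.map (CommRingCat.ofHom (algebraMap k K)))) (g := f) ?_ inferInstance
  refine IsPullback.flip (IsPullback.of_right (h₁₂ := pullback.snd _ _) (h₂₂ := t)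
    (v₁₃ := Spec.map (CommRingCat.ofHom (algebraMap k K))) ?_ ?_ ?_)
  · have e : extMap K (f ≫ t) t f rfl ≫ pullback.snd _ _ = pullback.snd _ _ := by
      rw [extMap, pullback.map, pullback.lift_snd, Category.comp_id]
    rw [e]
    exact (IsPullback.of_hasPullback (f ≫ t)
      (Spec.map (CommRingCat.ofHom (algebraMap k K)))).flip
  · rw [extMap, pullback.map, pullback.lift_fst]
  · exact (IsPullback.of_hasPullback t (Spec.map (CommRingCat.ofHom (algebraMap k K)))).flip

/-- The pullback of 0-cycles along the projection `V_K ⟶ V`. The fibre over a closed point `P` is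
the finite `K`-scheme `Spec (κ(P) ⊗ K)`, so that its components are closed points of `V_K`. -/
def extCycle {V : Scheme.{u}} (s : V ⟶ Spec (.of k)) (a : Z0 V) : Z0 (ext K s) :=
  (flatPullback (pullback.fst s (Spec.map (CommRingCat.ofHom (algebraMap k K)))) a).zeroDim

/-- The class of the 0-cycle `a` on a `K`-scheme `V` is the class of a `K`-rational point. -/
def IsClassOfRationalPoint {V : Scheme.{u}} (s : V ⟶ Spec (.of K)) (a : Z0 V) : Prop :=
  ∃ (σ : Spec (.of K) ⟶ V) (P : closedPoints V), σ ≫ s = 𝟙 _ ∧ P.1 ∈ Set.range σ ∧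
    (QuotientAddGroup.mk a : CH0 V) = QuotientAddGroup.mk (Finsupp.single P 1)

end BaseChange

end ZeroCycles

end

open ZeroCycles

/-!
All the multiplicities that occur are equal to one, so that every cycle in the statement can be
described by the coefficients of points.

*Over `k`.* Let `H : W = X ×_k Y`, and let `w` lie over closed points `P` and `Q`. The residue
field of `P` is finite separable over `k`, as the characteristic is zero, so the fibre of `W ⟶ X`
over `P` is étale over `Y`. Hence `𝒪_w / 𝔪_P 𝒪_w` is flat over `𝒪_Q`
(`flat_quotient_map_stalk`) and `𝔪_w = 𝔪_P 𝒪_w + 𝔪_Q 𝒪_w` (`maximalIdeal_eq_sup`). The two ideals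
on the right are the primes of the fibres through `w`, which are integral because `X` and `Y` are
geometrically integral. Flatness kills the higher `Tor` and the second equation gives the
zeroth one length one, so that Serre's multiplicity at `w` is one (`intersectionMult_eq_one`). The
coefficient of `w` in `p₁^* x ∩ p₂^* y` is thus the product of the coefficient of `P` in `x` and
that of `Q` in `y` (`mult_zeroDim_intersect`). The same two facts give the
codimension formula behind `meetProperly_flatPullback`.

*Over `K = k_v`.* Extension of scalars of 0-cycles keeps coefficients
(`mult_extCycle`), so the extension of `p₁^* x ∩ p₂^* y` is the exterior product of the
extensions of `x` and `y`. If `z_v` is the class of a rational point `R`, then `R` is the exterior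
product of its two projections, and the claim follows from bilinearity once the exterior product
is known to respect rational equivalence in each variable (`exists_exteriorProduct`,
`classMod_exteriorProduct_eq`).

*Rational equivalence.* The exterior product of a 0-cycle `a` on `X` with a closed point `Q` of `Y`
is obtained by pulling `a` back to `X_{κ(Q)}` and pushing forward along the closed
immersion `X_{κ(Q)} ⟶ W`. The pushforward preserves rational equivalence by functoriality. For the
pullback along a finite extension `L / K` of the base field
(`flatPullback_mem_rationallyTrivial`), take a normal curve `f : C ⟶ X` with a rational function
`g`. Pullback commutes with `f_*` (`flatPullback_pushforward`): this is the equality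
`∑ [κ(d) : κ(x')] = [κ(c) : κ(x)]` over the points `d` of `C_L` above `c` and `x'`, which
holds because `κ(c) ⊗ κ(x')` is reduced. Finally `C_L ⟶ C` is finite étale, so that the local rings
of `C_L` at closed points are discrete valuation rings with the same uniformizers; its irreducible
components are open and closed normal curves, and `div g` pulls back to the sum of the divisors of
`g` on them (`flatPullback_divisor_mem`).
-/

noncomputable section

namespace ZeroCycles

/-! ### Fibres of a morphism and their local rings -/

/-- A morphism from a local scheme factors through the local ring at the image of the closed
point. -/
lemma exists_SpecMap_fromSpecStalk {F : Scheme.{u}} {R : CommRingCat.{u}} [IsLocalRing R]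
    (c : Spec R ⟶ F) {w : F} (h : c (IsLocalRing.closedPoint R) = w) :
    ∃ φ : F.presheaf.stalk w ⟶ R, Spec.map φ ≫ F.fromSpecStalk w = c := by
  subst h
  exact ⟨Scheme.stalkClosedPointTo c, Scheme.Spec_stalkClosedPointTo_fromSpecStalk c⟩

lemma fiberι_stalkMap_surjective {W X : Scheme.{u}} (q : W ⟶ X) (x : X) (w : q.fiber x) :
    Function.Surjective ((q.fiberι x).stalkMap w).hom :=
  (q.fiberι x).stalkMap_surjective w

lemma isField_stalk_Spec (κ : Type u) [Field κ] (p : Spec (.of κ)) :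
    IsField ((Spec (.of κ)).presheaf.stalk p) := by
  have h : p = genericPoint (Spec (.of κ)) := Subsingleton.elim (α := PrimeSpectrum κ) _ _
  rw [h]
  exact Field.toIsField (Spec (.of κ)).functionField

/-- A morphism that factors through a point whose local ring is a field kills the maximal ideal. -/
lemma stalkMap_eq_zero_of_mem_maximalIdeal {F X Z : Scheme.{u}} {j : F ⟶ X} {s : F ⟶ Z}
    {t : Z ⟶ X} (h : j = s ≫ t) (w : F) (hf : IsField (Z.presheaf.stalk (s w)))
    {a : X.presheaf.stalk (j w)} (ha : a ∈ IsLocalRing.maximalIdeal (X.presheaf.stalk (j w))) :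
    (j.stalkMap w).hom a = 0 := by
  subst h
  rw [Scheme.Hom.stalkMap_comp]
  have h2 : (t.stalkMap (s w)).hom a = 0 := by
    by_contra h0
    let := hf.toField
    have hu : IsUnit ((t.stalkMap (s w)).hom a) := by
      obtain ⟨b, hb⟩ := hf.mul_inv_cancel h0
      exact IsUnit.of_mul_eq_one _ hb
    have hloc : IsLocalHom (t.stalkMap (s w)).hom := inferInstance
    exact (IsLocalRing.mem_maximalIdeal _).1 ha (hloc.map_nonunit a hu)
  exact (congrArg (s.stalkMap w).hom h2).trans (map_zero _)

/-- The local ring of the fibre `F` over `x` at `w` is `𝒪_w / 𝔪_x 𝒪_w`: the stalk map of `F ⟶ W`,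
which is surjective, has kernel `𝔪_x 𝒪_w`. That the kernel is no larger follows from the universal
property of `F`. -/
lemma ker_stalkMap_of_isPullback {W X F : Scheme.{u}} (q : W ⟶ X) (x : X) (i : F ⟶ W)
    (s : F ⟶ Spec (X.residueField x)) (H : IsPullback i s q (X.fromSpecResidueField x))
    (w : F) :
    RingHom.ker (i.stalkMap w).hom =
      (IsLocalRing.maximalIdeal (X.presheaf.stalk (q (i w)))).map (q.stalkMap (i w)).hom := by
  have hi : IsPreimmersion i := MorphismProperty.of_isPullback H.flip inferInstance
  have hx : q (i w) = x := by
    have h1 : q (i w) = (i ≫ q) w := by simp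
    rw [h1, H.w]
    simp
  subst hx
  set I := (IsLocalRing.maximalIdeal (X.presheaf.stalk (q (i w)))).map (q.stalkMap (i w)).hom
    with hI
  apply le_antisymm
  · -- the closed subscheme `Spec (𝒪_w / 𝔪_x 𝒪_w)` factors through the fibre
    have hIm : I ≤ IsLocalRing.maximalIdeal (W.presheaf.stalk (i w)) :=
      ((IsLocalRing.local_hom_TFAE (q.stalkMap (i w)).hom).out 0 2 rfl rfl).1 inferInstance
    have : Nontrivial (W.presheaf.stalk (i w) ⧸ I) := Ideal.Quotient.nontrivial_iff.2
      (ne_top_of_le_ne_top (IsLocalRing.maximalIdeal.isMaximal _).ne_top hIm)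
    have : IsLocalRing (W.presheaf.stalk (i w) ⧸ I) :=
      .of_surjective' (Ideal.Quotient.mk I) Ideal.Quotient.mk_surjective
    let π : W.presheaf.stalk (i w) ⟶ CommRingCat.of (W.presheaf.stalk (i w) ⧸ I) :=
      CommRingCat.ofHom (Ideal.Quotient.mk I)
    let β : X.residueField (q (i w)) ⟶ CommRingCat.of (W.presheaf.stalk (i w) ⧸ I) :=
      CommRingCat.ofHom (Ideal.Quotient.lift _
        ((Ideal.Quotient.mk I).comp (q.stalkMap (i w)).hom) fun a ha =>
          Ideal.Quotient.eq_zero_iff_mem.2 (Ideal.mem_map_of_mem _ ha))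
    have hβ : X.residue _ ≫ β = q.stalkMap (i w) ≫ π := by
      ext a
      rfl
    have hw : (Spec.map π ≫ W.fromSpecStalk (i w)) ≫ q =
        Spec.map β ≫ X.fromSpecResidueField (q (i w)) := by
      rw [Category.assoc, ← Scheme.SpecMap_stalkMap_fromSpecStalk, Scheme.fromSpecResidueField,
        ← Spec.map_comp_assoc, ← Spec.map_comp_assoc, hβ]
    obtain ⟨l, hl⟩ : ∃ l, l ≫ i = Spec.map π ≫ W.fromSpecStalk (i w) :=
      ⟨_, H.lift_fst _ _ hw⟩
    have hpt : l (IsLocalRing.closedPoint _) = w := by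
      apply i.isEmbedding.injective
      have h1 : i (l (IsLocalRing.closedPoint _)) =
        W.fromSpecStalk (i w) (Spec.map π (IsLocalRing.closedPoint _)) :=
          congr($hl (IsLocalRing.closedPoint _))
      refine h1.trans ?_
      have : IsLocalHom π.hom := by
        exact IsLocalHom.of_surjective _ Ideal.Quotient.mk_surjective
      have h2 : Spec.map π (IsLocalRing.closedPoint _) = IsLocalRing.closedPoint _ :=
        IsLocalRing.comap_closedPoint π.hom
      rw [h2, Scheme.fromSpecStalk_closedPoint]
    obtain ⟨φ, hφ⟩ := exists_SpecMap_fromSpecStalk l hpt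
    have key : i.stalkMap w ≫ φ = π := by
      apply Spec.map_injective
      rw [← cancel_mono (W.fromSpecStalk (i w)), Spec.map_comp, Category.assoc,
        Scheme.SpecMap_stalkMap_fromSpecStalk, reassoc_of% hφ, hl]
    intro a ha
    have h3 : π.hom a = 0 := by
      rw [← key]
      simp [RingHom.mem_ker.1 ha]
    exact Ideal.Quotient.eq_zero_iff_mem.1 h3
  · rw [hI, Ideal.map_le_iff_le_comap]
    intro a ha
    have h := stalkMap_eq_zero_of_mem_maximalIdeal H.w w (isField_stalk_Spec _ _) (a := a) ha
    rwa [Scheme.Hom.stalkMap_comp] at h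

/-! ### Products over a field of characteristic zero -/

/-- The residue field of a closed point is finite over the base field (Nullstellensatz). -/
lemma isFinite_fromSpecResidueField_comp {k : Type u} [Field k] {X : Scheme.{u}}
    (f : X ⟶ Spec (.of k)) [LocallyOfFiniteType f] {x : X} (hx : x ∈ closedPoints X) :
    IsFinite (X.fromSpecResidueField x ≫ f) := by
  have h := isClosed_singleton_iff_isClosedImmersion.1 (mem_closedPoints_iff.1 hx)
  rw [isFinite_iff_locallyOfFiniteType_of_jacobsonSpace]
  infer_instance

lemma etale_SpecMap_of_isFinite {k : Type u} [Field k] [CharZero k] {L : Type u} [Field L]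
    (φ : Spec (.of L) ⟶ Spec (.of k)) [IsFinite φ] : Etale φ := by
  obtain ⟨φ, rfl⟩ := Spec.map_surjective φ
  have h : φ.hom.Finite := (IsFinite.SpecMap_iff φ).1 inferInstance
  rw [HasRingHomProperty.Spec_iff (P := @Etale)]
  algebraize [φ.hom]
  have : Module.Finite k L := h
  change Algebra.Etale k L
  have : Algebra.FormallyEtale k L := Algebra.FormallyEtale.of_isSeparable k L
  have : Algebra.FinitePresentation k L := Algebra.FinitePresentation.of_finiteType.1 inferInstance
  exact ⟨inferInstance, inferInstance⟩

/-- The fibre over `x` of the projection of `X ×_S Y` to `X` is the base change of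
`Spec κ(x) ⟶ S` along `Y ⟶ S`; in particular it inherits the properties of `Spec κ(x) ⟶ S` as a
scheme over `Y`. -/
lemma isPullback_fiber {S W X Y : Scheme.{u}} {q₁ : W ⟶ X} {q₂ : W ⟶ Y} {f : X ⟶ S} {g : Y ⟶ S}
    (H : IsPullback q₁ q₂ f g) (x : X) :
    IsPullback (q₁.fiberι x ≫ q₂) (q₁.fiberToSpecResidueField x) g
      (X.fromSpecResidueField x ≫ f) := by
  have h1 : IsPullback (q₁.fiberι x) (q₁.fiberToSpecResidueField x) q₁
    (X.fromSpecResidueField x) := IsPullback.of_hasPullback _ _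
  exact h1.paste_horiz H.flip

/-- If the residue field of `x` is étale over the base, a point `w` of the product is unramified
over `Y` within the fibre over `x`, which amounts to `𝔪_w = 𝔪_x 𝒪_w + 𝔪_y 𝒪_w`. -/
lemma maximalIdeal_eq_sup {S W X Y : Scheme.{u}} {q₁ : W ⟶ X} {q₂ : W ⟶ Y} {f : X ⟶ S}
    {g : Y ⟶ S} (H : IsPullback q₁ q₂ f g) (w : W)
    [h : Etale (X.fromSpecResidueField (q₁ w) ≫ f)] :
    IsLocalRing.maximalIdeal (W.presheaf.stalk w) =
      (IsLocalRing.maximalIdeal (X.presheaf.stalk (q₁ w))).map (q₁.stalkMap w).hom ⊔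
      (IsLocalRing.maximalIdeal (Y.presheaf.stalk (q₂ w))).map (q₂.stalkMap w).hom := by
  obtain ⟨x, hx⟩ : ∃ x, q₁ w = x := ⟨_, rfl⟩
  rw [hx] at h
  obtain ⟨w, rfl⟩ : ∃ w', q₁.fiberι x w' = w := by
    have : w ∈ q₁ ⁻¹' {x} := hx
    rwa [← q₁.range_fiberι x] at this
  have he : Etale (q₁.fiberι x ≫ q₂) :=
    MorphismProperty.of_isPullback (isPullback_fiber H x).flip h
  have hmap : (IsLocalRing.maximalIdeal (Y.presheaf.stalk ((q₁.fiberι x ≫ q₂) w))).map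
      ((q₁.fiberι x ≫ q₂).stalkMap w).hom =
      IsLocalRing.maximalIdeal ((q₁.fiber x).presheaf.stalk w) := by
    have h1 := LocallyOfFiniteType.stalkMap (q₁.fiberι x ≫ q₂) w
    have h2 := FormallyUnramified.stalkMap (q₁.fiberι x ≫ q₂) w
    have h3 : IsLocalHom ((q₁.fiberι x ≫ q₂).stalkMap w).hom := inferInstance
    algebraize [((q₁.fiberι x ≫ q₂).stalkMap w).hom]
    exact Algebra.FormallyUnramified.map_maximalIdeal
  rw [Scheme.Hom.stalkMap_comp] at hmap
  have hker := ker_stalkMap_of_isPullback q₁ x (q₁.fiberι x) (q₁.fiberToSpecResidueField x)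
    (IsPullback.of_hasPullback _ _) w
  rw [← hker, sup_comm, ← Ideal.comap_map_of_surjective' _ (fiberι_stalkMap_surjective q₁ x w),
    Ideal.map_map]
  have h4 : IsLocalHom ((q₁.fiberι x).stalkMap w).hom := inferInstance
  rw [← (((IsLocalRing.local_hom_TFAE ((q₁.fiberι x).stalkMap w).hom).out 0 4 rfl rfl).1 h4),
    ← hmap]
  rfl

/-- The fibre over `x` is flat over `Y`, so that `𝒪_w / 𝔪_x 𝒪_w` is flat over `𝒪_y`. -/
lemma flat_quotient_map_stalk {S W X Y : Scheme.{u}} {q₁ : W ⟶ X} {q₂ : W ⟶ Y} {f : X ⟶ S}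
    {g : Y ⟶ S} (H : IsPullback q₁ q₂ f g) (w : W)
    [h : Flat (X.fromSpecResidueField (q₁ w) ≫ f)] :
    ((Ideal.Quotient.mk ((IsLocalRing.maximalIdeal (X.presheaf.stalk (q₁ w))).map
      (q₁.stalkMap w).hom)).comp (q₂.stalkMap w).hom).Flat := by
  obtain ⟨x, hx⟩ : ∃ x, q₁ w = x := ⟨_, rfl⟩
  rw [hx] at h
  obtain ⟨w, rfl⟩ : ∃ w', q₁.fiberι x w' = w := by
    have : w ∈ q₁ ⁻¹' {x} := hx
    rwa [← q₁.range_fiberι x] at this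
  have he : Flat (q₁.fiberι x ≫ q₂) :=
    MorphismProperty.of_isPullback (isPullback_fiber H x).flip h
  have hmap := Flat.stalkMap (q₁.fiberι x ≫ q₂) w
  rw [Scheme.Hom.stalkMap_comp] at hmap
  have hker := ker_stalkMap_of_isPullback q₁ x (q₁.fiberι x) (q₁.fiberToSpecResidueField x)
    (IsPullback.of_hasPullback _ _) w
  rw [← hker]
  let E := RingHom.quotientKerEquivOfSurjective (fiberι_stalkMap_surjective q₁ x w)
  have h5 : (Ideal.Quotient.mk (RingHom.ker ((q₁.fiberι x).stalkMap w).hom)).comp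
      (q₂.stalkMap (q₁.fiberι x w)).hom = E.symm.toRingHom.comp
        ((((q₁.fiberι x).stalkMap w).hom).comp (q₂.stalkMap (q₁.fiberι x w)).hom) := by
    ext a
    apply E.injective
    simp [E]
  rw [h5]
  exact RingHom.Flat.comp hmap (RingHom.Flat.of_bijective E.symm.bijective)

/-! ### Codimension, and generic points of fibres -/

open IsLocalRing in
/-- Dimensions add in the situation of a product: apply the dimension formula for flat local
homomorphisms to `A → R`, with fibre `R / 𝔪_A R`, and to `B → R / 𝔪_A R`, whose fibre is a field. -/
lemma height_maximalIdeal_eq_add {A B R : Type u} [CommRing A] [CommRing B] [CommRing R]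
    [IsLocalRing A] [IsLocalRing B] [IsLocalRing R] [IsNoetherianRing A]
    [IsNoetherianRing B] [IsNoetherianRing R]
    (φ : A →+* R) (ψ : B →+* R) [IsLocalHom φ] [IsLocalHom ψ] (hφ : φ.Flat)
    (hψ : ((Ideal.Quotient.mk ((maximalIdeal A).map φ)).comp ψ).Flat)
    (hm : maximalIdeal R = (maximalIdeal A).map φ ⊔ (maximalIdeal B).map ψ) :
    (maximalIdeal R).height = (maximalIdeal A).height + (maximalIdeal B).height := by
  set I := (maximalIdeal A).map φ with hI
  algebraize [φ]
  have h1 : (maximalIdeal R).LiesOver (maximalIdeal A) := by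
    refine ⟨?_⟩
    exact ((((local_hom_TFAE φ).out 0 4 rfl rfl).1 ‹_›)).symm
  rw [Ideal.height_eq_height_add_of_liesOver_of_hasGoingDown (maximalIdeal A) (maximalIdeal R)]
  congr 1
  change ((maximalIdeal R).map (Ideal.Quotient.mk I)).height = _
  have hIm : I ≤ maximalIdeal R := hm ▸ le_sup_left
  have : Nontrivial (R ⧸ I) := Ideal.Quotient.nontrivial_iff.2
    (ne_top_of_le_ne_top (maximalIdeal.isMaximal R).ne_top hIm)
  have : IsLocalRing (R ⧸ I) := .of_surjective' (Ideal.Quotient.mk I) Ideal.Quotient.mk_surjective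
  have hloc : IsLocalHom (Ideal.Quotient.mk I) :=
    IsLocalHom.of_surjective _ Ideal.Quotient.mk_surjective
  have hmm : (maximalIdeal R).map (Ideal.Quotient.mk I) = maximalIdeal (R ⧸ I) :=
    IsLocalRing.map_maximalIdeal_of_surjective _ Ideal.Quotient.mk_surjective
  rw [hmm]
  have hm2 : maximalIdeal (R ⧸ I) = (maximalIdeal B).map ((Ideal.Quotient.mk I).comp ψ) := by
    rw [← hmm, hm, Ideal.map_sup, Ideal.map_quotient_self, bot_sup_eq, Ideal.map_map]
  have hloc2 : IsLocalHom ((Ideal.Quotient.mk I).comp ψ) := inferInstance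
  set χ := (Ideal.Quotient.mk I).comp ψ with hχ
  algebraize [χ]
  have h2 : (maximalIdeal (R ⧸ I)).LiesOver (maximalIdeal B) := by
    refine ⟨?_⟩
    exact ((((local_hom_TFAE χ).out 0 4 rfl rfl).1 ‹_›)).symm
  rw [Ideal.height_eq_height_add_of_liesOver_of_hasGoingDown (maximalIdeal B)
    (maximalIdeal (R ⧸ I))]
  have h3 : (maximalIdeal (R ⧸ I)).map (Ideal.Quotient.mk ((maximalIdeal B).map
      (algebraMap B (R ⧸ I)))) = ⊥ := by
    rw [RingHom.algebraMap_toAlgebra, ← hm2, Ideal.map_quotient_self]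
  have : Nontrivial ((R ⧸ I) ⧸ ((maximalIdeal B).map (algebraMap B (R ⧸ I)))) := by
    rw [RingHom.algebraMap_toAlgebra, ← hm2]
    infer_instance
  rw [h3, Ideal.height_bot, add_zero]

lemma coheight_eq_height {V : Scheme.{u}} (x : V) :
    Order.coheight x = (IsLocalRing.maximalIdeal (V.presheaf.stalk x)).height := by
  have h := ringKrullDim_stalk_eq_coheight x
  rw [← IsLocalRing.maximalIdeal_height_eq_ringKrullDim] at h
  exact_mod_cast h.symm

lemma coheight_eq_add {S W X Y : Scheme.{u}} {q₁ : W ⟶ X} {q₂ : W ⟶ Y} {f : X ⟶ S}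
    {g : Y ⟶ S} (H : IsPullback q₁ q₂ f g) [IsLocallyNoetherian W] [IsLocallyNoetherian X]
    [IsLocallyNoetherian Y] [Flat q₁] (w : W)
    [h : Etale (X.fromSpecResidueField (q₁ w) ≫ f)] :
    Order.coheight w = Order.coheight (q₁ w) + Order.coheight (q₂ w) := by
  simp only [coheight_eq_height]
  have h1 : IsLocalHom (q₁.stalkMap w).hom := inferInstance
  have h2 : IsLocalHom (q₂.stalkMap w).hom := inferInstance
  exact height_maximalIdeal_eq_add (q₁.stalkMap w).hom (q₂.stalkMap w).hom (Flat.stalkMap q₁ w)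
    (flat_quotient_map_stalk H w) (maximalIdeal_eq_sup H w)

/-- The generic point of an irreducible fibre, as a point of the total space. -/
def fiberGenericPoint {W X : Scheme.{u}} (q : W ⟶ X) (x : X) [IrreducibleSpace (q.fiber x)] : W :=
  q.fiberι x (genericPoint (q.fiber x))

lemma map_fiberι_apply {W X : Scheme.{u}} (q : W ⟶ X) (x : X) (w : q.fiber x) :
    q (q.fiberι x w) = x := by
  have : q.fiberι x w ∈ q ⁻¹' {x} := by
    rw [← q.range_fiberι x]
    exact ⟨w, rfl⟩
  exact this

lemma map_fiberGenericPoint {W X : Scheme.{u}} (q : W ⟶ X) (x : X)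
    [IrreducibleSpace (q.fiber x)] : q (fiberGenericPoint q x) = x :=
  map_fiberι_apply q x _

lemma exists_fiberι_apply_eq {W X : Scheme.{u}} (q : W ⟶ X) {x : X} {w : W} (h : q w = x) :
    ∃ w', q.fiberι x w' = w := by
  have : w ∈ q ⁻¹' {x} := h
  rwa [← q.range_fiberι x] at this

lemma fiberGenericPoint_specializes {W X : Scheme.{u}} (q : W ⟶ X) {x : X}
    [IrreducibleSpace (q.fiber x)] {w : W} (h : q w = x) : fiberGenericPoint q x ⤳ w := by
  obtain ⟨w, rfl⟩ := exists_fiberι_apply_eq q h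
  exact (genericPoint_specializes w).map (q.fiberι x).continuous

lemma genericPts_preimage_singleton {W X : Scheme.{u}} (q : W ⟶ X) (x : X)
    [IrreducibleSpace (q.fiber x)] : genericPts (q ⁻¹' {x}) = {fiberGenericPoint q x} := by
  ext w
  constructor
  · rintro ⟨hw, hw'⟩
    exact (hw' _ (map_fiberGenericPoint q x) (fiberGenericPoint_specializes q hw)).symm
  · rintro rfl
    refine ⟨map_fiberGenericPoint q x, fun w hw h => ?_⟩
    exact (h.antisymm (fiberGenericPoint_specializes q hw)).eq

/-- An integral fibre is cut out at each of its points by the maximal ideal of the base. -/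
lemma primeOf_fiberGenericPoint {W X : Scheme.{u}} (q : W ⟶ X) {x : X} [IsIntegral (q.fiber x)]
    {w : W} (h : fiberGenericPoint q x ⤳ w) (hx : q w = x) :
    primeOf h = (IsLocalRing.maximalIdeal (X.presheaf.stalk (q w))).map (q.stalkMap w).hom := by
  obtain ⟨w, rfl⟩ := exists_fiberι_apply_eq q hx
  rw [← ker_stalkMap_of_isPullback q x (q.fiberι x) (q.fiberToSpecResidueField x)
    (IsPullback.of_hasPullback _ _) w]
  have hs := genericPoint_specializes w
  have key := Scheme.Hom.stalkSpecializes_stalkMap (q.fiberι x) _ _ hs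
  have hm : IsLocalRing.maximalIdeal (W.presheaf.stalk (fiberGenericPoint q x)) =
      RingHom.ker ((q.fiberι x).stalkMap (genericPoint (q.fiber x))).hom := by
    have h4 : IsLocalHom ((q.fiberι x).stalkMap (genericPoint (q.fiber x))).hom := inferInstance
    have h5 := ((IsLocalRing.local_hom_TFAE ((q.fiberι x).stalkMap
      (genericPoint (q.fiber x))).hom).out 0 4 rfl rfl).1 h4
    rw [RingHom.ker_eq_comap_bot]
    refine h5.symm.trans ?_
    congr 1
    exact IsLocalRing.isField_iff_maximalIdeal_eq.1 (Field.toIsField (q.fiber x).functionField)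
  ext a
  have h6 : ((q.fiberι x).stalkMap (genericPoint (q.fiber x))).hom
    ((W.presheaf.stalkSpecializes h).hom a) =
    algebraMap _ (q.fiber x).functionField (((q.fiberι x).stalkMap w).hom a) :=
      congr($(key).hom a)
  have h7 : a ∈ primeOf h ↔ ((q.fiberι x).stalkMap (genericPoint (q.fiber x))).hom
      ((W.presheaf.stalkSpecializes h).hom a) = 0 := by
    rw [primeOf, hm]
    exact Iff.rfl
  rw [h7, h6, RingHom.mem_ker]
  exact map_eq_zero_iff _ (IsFractionRing.injective _ _)

/-! ### Serre multiplicities -/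

open scoped TensorProduct in
/-- For an `R`-module `M` that is flat over `A`, the functor `N ↦ M ⊗[R] (R ⊗[A] N) = M ⊗[A] N`
is exact. -/
lemma exact_lTensor_baseChange {A R M P Q T : Type u} [CommRing A] [CommRing R] [Algebra A R]
    [AddCommGroup M] [Module R M] [Module A M] [IsScalarTower A R M] [Module.Flat A M]
    [AddCommGroup P] [AddCommGroup Q] [AddCommGroup T] [Module A P] [Module A Q] [Module A T]
    {g : P →ₗ[A] Q} {h : Q →ₗ[A] T} (hgh : Function.Exact g h) :
    Function.Exact (LinearMap.lTensor M (g.baseChange R))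
      (LinearMap.lTensor M (h.baseChange R)) := by
  have h1 := Module.Flat.lTensor_exact M hgh
  let e (N : Type u) [AddCommGroup N] [Module A N] : M ⊗[R] (R ⊗[A] N) ≃ₗ[R] M ⊗[A] N :=
    TensorProduct.AlgebraTensorModule.cancelBaseChange A R R M N
  have key (N N' : Type u) [AddCommGroup N] [Module A N] [AddCommGroup N'] [Module A N']
      (l : N →ₗ[A] N') (t : M ⊗[R] (R ⊗[A] N)) :
      e N' (LinearMap.lTensor M (l.baseChange R) t) = LinearMap.lTensor M l (e N t) := by
    have : (e N').toLinearMap ∘ₗ (LinearMap.lTensor M (l.baseChange R)) =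
      (TensorProduct.AlgebraTensorModule.lTensor R M l) ∘ₗ (e N).toLinearMap := by
      ext; simp [e]
    exact congr($this t)
  intro t
  rw [← (e T).map_eq_zero_iff, key]
  rw [h1]
  constructor
  · rintro ⟨s, hs⟩
    refine ⟨(e P).symm s, (e Q).injective ?_⟩
    rw [key, LinearEquiv.apply_symm_apply, hs]
  · rintro ⟨s, rfl⟩
    exact ⟨e P s, (key _ _ _ _).symm⟩

open MonoidalCategory in
lemma exact_map_extendScalars_tensorLeft {A R : Type u} [CommRing A] [CommRing R] (φ : A →+* R)
    (M : ModuleCat.{u} R) (hM : Module.Flat A ((ModuleCat.restrictScalars φ).obj M))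
    (C : ShortComplex (ModuleCat.{u} A)) (hC : C.Exact) :
    ((C.map (ModuleCat.extendScalars φ)).map (tensorLeft M)).Exact := by
  rw [ShortComplex.ShortExact.moduleCat_exact_iff_function_exact] at hC ⊢
  let := φ.toAlgebra
  let : Module A M := Module.compHom M φ
  have : IsScalarTower A R M := ⟨fun a b m => mul_smul (φ a) b m⟩
  have : Module.Flat A M := hM
  exact exact_lTensor_baseChange (R := R) (M := M) hC

open MonoidalCategory in
/-- Flat base change of `Tor`: for `R` flat over `A`, the base change of a projective resolution of
`N` is a projective resolution of `R ⊗[A] N`, and `M ⊗[R] -` keeps it exact when `M` is flat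
over `A`. -/
lemma isZero_Tor_extendScalars {A R : Type u} [CommRing A] [CommRing R] (φ : A →+* R)
    (hφ : φ.Flat) (M : ModuleCat.{u} R)
    (hM : Module.Flat A ((ModuleCat.restrictScalars φ).obj M)) (N : ModuleCat.{u} A) (n : ℕ) :
    IsZero (((Tor (ModuleCat.{u} R) (n + 1)).obj M).obj ((ModuleCat.extendScalars φ).obj N)) := by
  have hl := ModuleCat.preservesFiniteLimits_extendScalars_of_flat hφ
  have adj := ModuleCat.extendRestrictScalarsAdj.{u} φ
  have hproj : (ModuleCat.extendScalars.{u, u, u} φ).PreservesProjectiveObjects :=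
    ⟨fun h => adj.map_projective _ h⟩
  have hr : PreservesFiniteColimits (ModuleCat.extendScalars.{u, u, u} φ) :=
    ⟨fun J _ _ => adj.leftAdjoint_preservesColimits.preservesColimitsOfShape⟩
  have hadd : (ModuleCat.extendScalars.{u, u, u} φ).Additive :=
    adj.left_adjoint_additive
  have hhom : (ModuleCat.extendScalars.{u, u, u} φ).PreservesHomology := inferInstance
  let P := projectiveResolution N
  let P' := (ModuleCat.extendScalars.{u, u, u} φ).mapProjectiveResolution P
  refine IsZero.of_iso ?_ (P'.isoLeftDerivedObj ((tensoringLeft _).obj M) (n + 1))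
  have h1 : P.complex.ExactAt (n + 1) := P.complex_exactAt_succ n
  rw [HomologicalComplex.exactAt_iff] at h1
  have h2 := exact_map_extendScalars_tensorLeft φ M hM _ h1
  have h3 : ((((tensoringLeft (ModuleCat.{u} R)).obj M).mapHomologicalComplex _).obj
    P'.complex).ExactAt (n + 1) := h2
  exact h3.isZero_homology

/-- If `R` and `R / I` are flat over `A` and `I + J R` is the maximal ideal of `R`, then
`Tor (R / I) (R / J R)` is the residue field of `R`, placed in degree zero. -/
lemma length_Tor_quotient {A R : Type u} [CommRing A] [CommRing R] [IsLocalRing R] (φ : A →+* R)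
    (hφ : φ.Flat) (I : Ideal R) (J : Ideal A) (hI : ((Ideal.Quotient.mk I).comp φ).Flat)
    (hm : I ⊔ J.map φ = IsLocalRing.maximalIdeal R) (n : ℕ) :
    Module.length R (((Tor (ModuleCat.{u} R) n).obj (ModuleCat.of R (R ⧸ I))).obj
      (ModuleCat.of R (R ⧸ J.map φ))) = if n = 0 then 1 else 0 := by
  cases n with
  | zero =>
    have e1 : ((Tor (ModuleCat.{u} R) 0).obj (ModuleCat.of R (R ⧸ I))).obj
        (ModuleCat.of R (R ⧸ J.map φ)) ≅ _ :=
      ((MonoidalCategory.tensoringLeft (ModuleCat.{u} R)).obj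
        (ModuleCat.of R (R ⧸ I))).leftDerivedZeroIsoSelf.app (ModuleCat.of R (R ⧸ J.map φ))
    have e2 : TensorProduct R (R ⧸ I) (R ⧸ J.map φ) ≃ₗ[R] R ⧸ (I ⊔ J.map φ) :=
      ((Algebra.TensorProduct.quotIdealMapEquivTensorQuot (R ⧸ I)
        (J.map φ)).toLinearEquiv.restrictScalars R).symm.trans
        (DoubleQuot.quotQuotEquivQuotSupₐ R I (J.map φ)).toLinearEquiv
    rw [if_pos rfl, e1.toLinearEquiv.length_eq]
    refine e2.length_eq.trans ?_
    rw [hm, Module.length_eq_one_iff]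
    exact isSimpleModule_iff_isCoatom.2 (IsLocalRing.maximalIdeal.isMaximal R).1
  | succ n =>
    rw [if_neg n.succ_ne_zero]
    let := φ.toAlgebra
    have hM : Module.Flat A ((ModuleCat.restrictScalars φ).obj (ModuleCat.of R (R ⧸ I))) := hI
    have e : (ModuleCat.extendScalars φ).obj (ModuleCat.of A (A ⧸ J)) ≅
        ModuleCat.of R (R ⧸ J.map φ) :=
      LinearEquiv.toModuleIso
        (Algebra.TensorProduct.quotIdealMapEquivTensorQuot R J).toLinearEquiv.symm
    have h := isZero_Tor_extendScalars φ hφ (ModuleCat.of R (R ⧸ I)) hM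
      (ModuleCat.of A (A ⧸ J)) n
    have h' := h.of_iso (((Tor (ModuleCat.{u} R) (n + 1)).obj
      (ModuleCat.of R (R ⧸ I))).mapIso e.symm)
    rw [Module.length_eq_zero_iff]
    exact ModuleCat.subsingleton_of_isZero h'

/-- Two subvarieties meet with Serre multiplicity one at `z` if their primes generate the
maximal ideal and, for some flat `A → 𝒪_z`, the first is flat over `A` and the second is the
preimage of a closed subscheme of `Spec A`. -/
lemma intersectionMult_eq_one {V : Scheme.{u}} {s t z : V} (hs : s ⤳ z) (ht : t ⤳ z)
    {A : Type u} [CommRing A] (φ : A →+* V.presheaf.stalk z) (hφ : φ.Flat) (J : Ideal A)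
    (hJ : primeOf ht = J.map φ) (hI : ((Ideal.Quotient.mk (primeOf hs)).comp φ).Flat)
    (hm : primeOf hs ⊔ primeOf ht = IsLocalRing.maximalIdeal _) :
    intersectionMult hs ht = 1 := by
  rw [intersectionMult, hJ]
  rw [hJ] at hm
  simp only [length_Tor_quotient φ hφ _ J hI hm]
  rw [finsum_eq_single _ 0]
  · simp
  · intro n hn
    simp [hn]

/-! ### Coefficients of 0-cycles -/

/-- The coefficient of a point `p` in a 0-cycle `a`. It is defined for all points, being zero at
those that are not closed. -/
def mult {V : Scheme.{u}} (a : Z0 V) (p : V) : ℤ := Finsupp.mapDomain Subtype.val a p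

lemma mult_coe {V : Scheme.{u}} (a : Z0 V) (p : closedPoints V) : mult a p = a p :=
  Finsupp.mapDomain_apply Subtype.val_injective a p

lemma mult_of_notMem {V : Scheme.{u}} (a : Z0 V) {p : V} (hp : p ∉ closedPoints V) :
    mult a p = 0 :=
  Finsupp.mapDomain_of_notMem_range a p (by simpa using hp)

@[simp] lemma mult_add {V : Scheme.{u}} (a b : Z0 V) (p : V) :
    mult (a + b) p = mult a p + mult b p := by
  simp [mult, Finsupp.mapDomain_add]

lemma mult_single {V : Scheme.{u}} (P : closedPoints V) (n : ℤ) (p : V) [Decidable (p = P.1)] :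
    mult (Finsupp.single P n) p = if p = P.1 then n else 0 := by
  classical
  rw [mult, Finsupp.mapDomain_single, Finsupp.single_apply]
  simp only [eq_comm]

lemma mult_eq_sum {V : Scheme.{u}} (a : Z0 V) (p : V) [DecidableEq V] :
    mult a p = a.sum fun P n => if p = P.1 then n else 0 := by
  simp only [mult, Finsupp.mapDomain, Finsupp.sum_apply, Finsupp.single_apply, eq_comm]

lemma ext_mult {V : Scheme.{u}} {a b : Z0 V} (h : ∀ p, mult a p = mult b p) : a = b := by
  ext P
  rw [← mult_coe, ← mult_coe, h]

lemma finite_mult {V : Scheme.{u}} (a : Z0 V) : {p | mult a p ≠ 0}.Finite :=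
  (Finsupp.mapDomain Subtype.val a).hasFiniteSupport

lemma mult_single_eq {V : Scheme.{u}} (P : closedPoints V) (n : ℤ) (p : V) (hp : p = P.1) :
    mult (Finsupp.single P n) p = n := by
  classical
  rw [mult_single, if_pos hp]

lemma mult_single_of_ne {V : Scheme.{u}} (P : closedPoints V) (n : ℤ) (p : V) (hp : p ≠ P.1) :
    mult (Finsupp.single P n) p = 0 := by
  classical
  rw [mult_single, if_neg hp]

@[simp] lemma mult_zero {V : Scheme.{u}} (p : V) : mult (0 : Z0 V) p = 0 := by
  simp [mult]

lemma mult_sum {V : Scheme.{u}} {ι : Type*} (s : Finset ι) (a : ι → Z0 V) (p : V) :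
    mult (∑ i ∈ s, a i) p = ∑ i ∈ s, mult (a i) p := by
  classical
  induction s using Finset.induction_on with
  | empty => simp
  | insert i s hi ih => rw [Finset.sum_insert hi, Finset.sum_insert hi, mult_add, ih]

lemma mult_zsmul {V : Scheme.{u}} (n : ℤ) (a : Z0 V) (p : V) : mult (n • a) p = n * mult a p := by
  simp [mult, Finsupp.mapDomain_smul]

lemma mult_nsmul {V : Scheme.{u}} (n : ℕ) (a : Z0 V) (p : V) : mult (n • a) p = n * mult a p := by
  rw [← mult_zsmul, natCast_zsmul]

lemma mult_zeroDim {V : Scheme.{u}} (c : Cycle V) {p : V} (hp : p ∈ closedPoints V) :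
    mult c.zeroDim p = c p :=
  mult_coe c.zeroDim ⟨p, hp⟩

lemma zeroDim_add {V : Scheme.{u}} (a b : Cycle V) : (a + b).zeroDim = a.zeroDim + b.zeroDim :=
  Finsupp.subtypeDomain_add

lemma zeroDim_neg {V : Scheme.{u}} (a : Cycle V) : (-a).zeroDim = -a.zeroDim :=
  Finsupp.subtypeDomain_neg

/-! ### Points of a product over a given pair of points -/

section Points

variable {S W X Y : Scheme.{u}} {q₁ : W ⟶ X} {q₂ : W ⟶ Y} {f : X ⟶ S} {g : Y ⟶ S}

/-- There are no specializations between points of a product over the same pair of points `(x, y)`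
when `κ(x)` is finite over the base: they lie in a fibre of a finite morphism. -/
lemma eq_of_specializes_of_isFinite (H : IsPullback q₁ q₂ f g) {w z : W} (h : w ⤳ z)
    (h1 : q₁ w = q₁ z) (h2 : q₂ w = q₂ z)
    [hf : IsFinite (X.fromSpecResidueField (q₁ z) ≫ f)] : w = z := by
  obtain ⟨x, hx⟩ : ∃ x, q₁ z = x := ⟨_, rfl⟩
  rw [hx] at hf
  obtain ⟨w, rfl⟩ := exists_fiberι_apply_eq q₁ (h1.trans hx)
  obtain ⟨z, rfl⟩ := exists_fiberι_apply_eq q₁ hx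
  have he : IsFinite (q₁.fiberι x ≫ q₂) :=
    MorphismProperty.of_isPullback (isPullback_fiber H x).flip hf
  have hd := (q₁.fiberι x ≫ q₂).isDiscrete_preimage_singleton ((q₁.fiberι x ≫ q₂) z)
  have := hd.to_subtype
  have h' : w ⤳ z := (q₁.fiberι x).isEmbedding.isInducing.specializes_iff.1 h
  let A := (q₁.fiberι x ≫ q₂) ⁻¹' {(q₁.fiberι x ≫ q₂) z}
  have h3 : (⟨w, h2⟩ : A) ⤳ ⟨z, rfl⟩ := Topology.IsInducing.subtypeVal.specializes_iff.1 h'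
  exact congrArg (fun a : A => q₁.fiberι x a.1) h3.eq

lemma finite_setOf_map_eq (H : IsPullback q₁ q₂ f g) (x : X) (y : Y)
    [hf : IsFinite (X.fromSpecResidueField x ≫ f)] : {w | q₁ w = x ∧ q₂ w = y}.Finite := by
  have he : IsFinite (q₁.fiberι x ≫ q₂) :=
    MorphismProperty.of_isPullback (isPullback_fiber H x).flip hf
  refine (((q₁.fiberι x ≫ q₂).finite_preimage_singleton y).image (q₁.fiberι x)).subset ?_
  rintro w ⟨hx, hy⟩
  obtain ⟨w, rfl⟩ := exists_fiberι_apply_eq q₁ hx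
  exact ⟨w, hy, rfl⟩

end Points

lemma mem_closedPoints_of_isPullback {S W X Y : Scheme.{u}} {q₁ : W ⟶ X} {q₂ : W ⟶ Y} {f : X ⟶ S}
    {g : Y ⟶ S} (H : IsPullback q₁ q₂ f g) {w : W} (hx : q₁ w ∈ closedPoints X)
    (hy : q₂ w ∈ closedPoints Y) [hf : IsFinite (X.fromSpecResidueField (q₁ w) ≫ f)] :
    w ∈ closedPoints W := by
  have hc : IsClosed {z | q₁ z = q₁ w ∧ q₂ z = q₂ w} :=
    (hx.preimage q₁.continuous).inter (hy.preimage q₂.continuous)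
  rw [mem_closedPoints_iff, ← closure_subset_iff_isClosed]
  intro z hz
  have hz' := (closure_minimal (Set.singleton_subset_iff.2
    (show w ∈ {z | q₁ z = q₁ w ∧ q₂ z = q₂ w} from ⟨rfl, rfl⟩)) hc) hz
  have : w ⤳ z := specializes_iff_mem_closure.2 hz
  obtain ⟨h1, h2⟩ := hz'
  rw [← h1] at hf
  exact (eq_of_specializes_of_isFinite H this h1.symm h2.symm).symm

/-! ### Intersections of fibres in a product -/

lemma fibreCycle_eq_single {W X : Scheme.{u}} (q : W ⟶ X) (x : X) [IsIntegral (q.fiber x)] :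
    fibreCycle q x = Finsupp.single (fiberGenericPoint q x) 1 := by
  rw [fibreCycle, genericPts_preimage_singleton, finsum_mem_singleton]
  congr 1
  have h := primeOf_fiberGenericPoint q (specializes_rfl (x := fiberGenericPoint q x))
    (map_fiberGenericPoint q x)
  rw [← h, primeOf, TopCat.Presheaf.stalkSpecializes_refl]
  have h2 : Module.length (W.presheaf.stalk (fiberGenericPoint q x))
      (W.presheaf.stalk (fiberGenericPoint q x) ⧸
        IsLocalRing.maximalIdeal (W.presheaf.stalk (fiberGenericPoint q x))) = 1 :=
    Module.length_eq_one_iff.2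
      (isSimpleModule_iff_isCoatom.2 (IsLocalRing.maximalIdeal.isMaximal _).1)
  have h3 : (IsLocalRing.maximalIdeal (W.presheaf.stalk (fiberGenericPoint q x))).comap
    (𝟙 (W.presheaf.stalk (fiberGenericPoint q x)) : _ ⟶ _).hom =
      (IsLocalRing.maximalIdeal (W.presheaf.stalk (fiberGenericPoint q x))) := Ideal.comap_id _
  rw [h3, h2]
  simp

lemma flatPullback_eq_mapDomain {W X : Scheme.{u}} (q : W ⟶ X) [∀ x, IsIntegral (q.fiber x)]
    (a : Z0 X) :
    flatPullback q a = a.mapDomain fun P => fiberGenericPoint q P.1 := by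
  simp [flatPullback, Finsupp.mapDomain, fibreCycle_eq_single]
  refine congrArg (Finsupp.sum a) (funext fun P => ?_)
  ext n : 1
  simp

section Intersection

variable {S W X Y : Scheme.{u}} {q₁ : W ⟶ X} {q₂ : W ⟶ Y} {f : X ⟶ S} {g : Y ⟶ S}
  [∀ x, IsIntegral (q₁.fiber x)] [∀ y, IsIntegral (q₂.fiber y)]

lemma closure_inter_closure_eq {x : X} {y : Y} (hx : x ∈ closedPoints X)
    (hy : y ∈ closedPoints Y) :
    closure {fiberGenericPoint q₁ x} ∩ closure {fiberGenericPoint q₂ y} =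
      {w | q₁ w = x ∧ q₂ w = y} := by
  have key {W X : Scheme.{u}} (q : W ⟶ X) [∀ x, IsIntegral (q.fiber x)] {x : X}
      (hx : x ∈ closedPoints X) : closure {fiberGenericPoint q x} = {w | q w = x} := by
    apply subset_antisymm
    · exact closure_minimal (Set.singleton_subset_iff.2 (map_fiberGenericPoint q x))
        (hx.preimage q.continuous)
    · intro w hw
      exact specializes_iff_mem_closure.1 (fiberGenericPoint_specializes q hw)
  rw [key q₁ hx, key q₂ hy]
  rfl

lemma genericPts_inter_eq (H : IsPullback q₁ q₂ f g) {x : X} {y : Y} (hx : x ∈ closedPoints X)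
    (hy : y ∈ closedPoints Y) [hf : IsFinite (X.fromSpecResidueField x ≫ f)] :
    genericPts (closure {fiberGenericPoint q₁ x} ∩ closure {fiberGenericPoint q₂ y}) =
      {w | q₁ w = x ∧ q₂ w = y} := by
  rw [closure_inter_closure_eq hx hy]
  refine subset_antisymm (fun w hw => hw.1) fun w hw => ⟨hw, fun z hz h => ?_⟩
  obtain ⟨rfl, rfl⟩ := hw
  exact eq_of_specializes_of_isFinite H h hz.1 hz.2

lemma intersectionMult_fiberGenericPoint (H : IsPullback q₁ q₂ f g) [Flat q₁] [Flat q₂]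
    {x : X} {y : Y} {w : W}
    [Etale (X.fromSpecResidueField (q₁ w) ≫ f)]
    (hx : q₁ w = x) (hy : q₂ w = y)
    (hs : fiberGenericPoint q₁ x ⤳ w) (ht : fiberGenericPoint q₂ y ⤳ w) :
    intersectionMult hs ht = 1 := by
  have h1 := primeOf_fiberGenericPoint q₁ hs hx
  have h2 := primeOf_fiberGenericPoint q₂ ht hy
  refine intersectionMult_eq_one hs ht (q₂.stalkMap w).hom (Flat.stalkMap q₂ w) _ h2 ?_ ?_
  · rw [h1]
    exact flat_quotient_map_stalk H w
  · rw [h1, h2]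
    exact (maximalIdeal_eq_sup H w).symm

/-- Two fibres `P × Y` and `X × Q` meet in the points over `(P, Q)`, each with multiplicity one. -/
lemma intersectPts_apply (H : IsPullback q₁ q₂ f g) [Flat q₁] [Flat q₂]
    {x : X} {y : Y} (hx : x ∈ closedPoints X) (hy : y ∈ closedPoints Y)
    [hfe : Etale (X.fromSpecResidueField x ≫ f)]
    [hf : IsFinite (X.fromSpecResidueField x ≫ f)] (w : W) [Decidable (q₁ w = x ∧ q₂ w = y)] :
    intersectPts (fiberGenericPoint q₁ x) (fiberGenericPoint q₂ y) w =
      if q₁ w = x ∧ q₂ w = y then 1 else 0 := by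
  classical
  have hS := genericPts_inter_eq H hx hy
  have hfin : (genericPts (closure {fiberGenericPoint q₁ x} ∩
      closure {fiberGenericPoint q₂ y})).Finite := by
    rw [hS]
    exact finite_setOf_map_eq H x y
  have : Finite (genericPts (closure {fiberGenericPoint q₁ x} ∩
      closure {fiberGenericPoint q₂ y})) := hfin
  have hone : ∀ z : genericPts (closure {fiberGenericPoint q₁ x} ∩
      closure {fiberGenericPoint q₂ y}), intersectionMult
      (specializes_iff_mem_closure.2 z.2.1.1) (specializes_iff_mem_closure.2 z.2.1.2) = 1 := by
    rintro ⟨z, hz⟩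
    have hz' := hS.subset hz
    obtain ⟨h1, h2⟩ := hz'
    rw [← h1] at hfe
    exact intersectionMult_fiberGenericPoint H h1 h2 _ _
  have := Fintype.ofFinite (genericPts (closure {fiberGenericPoint q₁ x} ∩
      closure {fiberGenericPoint q₂ y}))
  rw [intersectPts]
  simp only [hone]
  rw [finsum_eq_sum_of_fintype, Finsupp.finsetSum_apply]
  simp only [Finsupp.single_apply]
  by_cases hw : q₁ w = x ∧ q₂ w = y
  · rw [if_pos hw, Finset.sum_eq_single ⟨w, hS.symm.subset hw⟩]
    · simp
    · rintro ⟨z, hz⟩ - hne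
      rw [if_neg]
      rintro rfl
      exact hne rfl
    · simp
  · rw [if_neg hw, Finset.sum_eq_zero]
    rintro ⟨z, hz⟩ -
    rw [if_neg]
    rintro rfl
    exact hw (hS.subset hz)

end Intersection

/-! ### Intersection product and extension of scalars -/

section Field

variable {k : Type u} [Field k] {W X Y : Scheme.{u}} {q₁ : W ⟶ X} {q₂ : W ⟶ Y}
  {f : X ⟶ Spec (.of k)} {g : Y ⟶ Spec (.of k)}

lemma etale_fromSpecResidueField_comp [CharZero k] (f : X ⟶ Spec (.of k)) [LocallyOfFiniteType f]
    {x : X} (hx : x ∈ closedPoints X) : Etale (X.fromSpecResidueField x ≫ f) := by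
  have h1 : IsFinite (X.fromSpecResidueField x ≫ f) := isFinite_fromSpecResidueField_comp f hx
  exact etale_SpecMap_of_isFinite (L := X.residueField x) _

/-- The fibre over `x` is flat over `Y`, so its generic point maps to a generic point of `Y`. -/
lemma isMax_map_fiberGenericPoint (H : IsPullback q₁ q₂ f g) (x : X)
    [IrreducibleSpace (q₁.fiber x)] : IsMax (q₂ (fiberGenericPoint q₁ x)) := by
  have hF : Flat (q₁.fiberι x ≫ q₂) :=
    MorphismProperty.of_isPullback (isPullback_fiber H x).flip
      (inferInstance : Flat (X.fromSpecResidueField x ≫ f))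
  intro y hy
  have hy' : y ⤳ (q₁.fiberι x ≫ q₂) (genericPoint (q₁.fiber x)) := hy
  obtain ⟨z, hz, hzy⟩ := Flat.generalizingMap (q₁.fiberι x ≫ q₂) hy'
  have h1 : z = genericPoint (q₁.fiber x) := (hz.antisymm (genericPoint_specializes z)).eq
  subst h1
  exact le_of_eq hzy.symm

lemma coheight_fiberGenericPoint [CharZero k] (H : IsPullback q₁ q₂ f g)
    [IsLocallyNoetherian W] [IsLocallyNoetherian X] [IsLocallyNoetherian Y] [LocallyOfFiniteType f]
    {x : X} (hx : x ∈ closedPoints X) [IrreducibleSpace (q₁.fiber x)] :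
    Order.coheight (fiberGenericPoint q₁ x) = Order.coheight x := by
  have h0 : Etale (X.fromSpecResidueField x ≫ f) := etale_fromSpecResidueField_comp f hx
  have hF : Flat q₁ := MorphismProperty.of_isPullback H.flip (inferInstance : Flat g)
  rw [← map_fiberGenericPoint q₁ x] at h0
  rw [coheight_eq_add H, Order.coheight_eq_zero.2 (isMax_map_fiberGenericPoint H x), add_zero,
    map_fiberGenericPoint]

lemma meetProperly_flatPullback [CharZero k] (H : IsPullback q₁ q₂ f g)
    [LocallyOfFiniteType f] [LocallyOfFiniteType g]
    [∀ x, IsIntegral (q₁.fiber x)] [∀ y, IsIntegral (q₂.fiber y)] (a : Z0 X) (b : Z0 Y) :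
    MeetProperly (flatPullback q₁ a) (flatPullback q₂ b) := by
  classical
  have hF : LocallyOfFiniteType q₁ :=
    MorphismProperty.of_isPullback H.flip (inferInstance : LocallyOfFiniteType g)
  have hX : IsLocallyNoetherian X := LocallyOfFiniteType.isLocallyNoetherian f
  have hY : IsLocallyNoetherian Y := LocallyOfFiniteType.isLocallyNoetherian g
  have hW : IsLocallyNoetherian W := LocallyOfFiniteType.isLocallyNoetherian q₁
  have hF : Flat q₁ := MorphismProperty.of_isPullback H.flip (inferInstance : Flat g)
  intro s hs t ht z hz
  rw [flatPullback_eq_mapDomain] at hs ht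
  obtain ⟨x, -, rfl⟩ := Finset.mem_image.1 (Finsupp.mapDomain_support hs)
  obtain ⟨y, -, rfl⟩ := Finset.mem_image.1 (Finsupp.mapDomain_support ht)
  have hfin := isFinite_fromSpecResidueField_comp f x.2
  have hz' := (genericPts_inter_eq H x.2 y.2).subset hz
  have hE := etale_fromSpecResidueField_comp f x.2
  rw [coheight_fiberGenericPoint H x.2, coheight_fiberGenericPoint H.flip y.2]
  rw [← hz'.1] at hE ⊢
  rw [← hz'.2]
  exact coheight_eq_add H z

lemma intersect_flatPullback_apply [CharZero k] (H : IsPullback q₁ q₂ f g)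
    [LocallyOfFiniteType f]
    [∀ x, IsIntegral (q₁.fiber x)] [∀ y, IsIntegral (q₂.fiber y)] (a : Z0 X) (b : Z0 Y) (w : W) :
    intersect (flatPullback q₁ a) (flatPullback q₂ b) w = mult a (q₁ w) * mult b (q₂ w) := by
  classical
  have hF : Flat q₁ := MorphismProperty.of_isPullback H.flip (inferInstance : Flat g)
  have hF' : Flat q₂ := MorphismProperty.of_isPullback H (inferInstance : Flat f)
  have hb (s : W) (m : ℤ) : ((flatPullback q₂ b).sum fun t n => (m * n) • intersectPts s t) =
      b.sum fun Q n => (m * n) • intersectPts s (fiberGenericPoint q₂ Q.1) := by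
    rw [flatPullback_eq_mapDomain]
    exact Finsupp.sum_mapDomain_index (fun t => by rw [mul_zero, zero_smul])
      (fun t n n' => by rw [mul_add, add_smul])
  have ha : intersect (flatPullback q₁ a) (flatPullback q₂ b) =
      a.sum fun P m => b.sum fun Q n =>
        (m * n) • intersectPts (fiberGenericPoint q₁ P.1) (fiberGenericPoint q₂ Q.1) := by
    simp only [intersect, hb]
    rw [flatPullback_eq_mapDomain]
    refine Finsupp.sum_mapDomain_index (fun t => ?_) (fun t n n' => ?_)
    · simp only [zero_mul, zero_smul, Finsupp.sum_fun_zero]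
    · simp only [add_mul, add_smul, Finsupp.sum_add]
  rw [ha]
  have key (x : closedPoints X) (y : closedPoints Y) :
      intersectPts (fiberGenericPoint q₁ x.1) (fiberGenericPoint q₂ y.1) w =
      if q₁ w = x ∧ q₂ w = y then 1 else 0 :=
    have := isFinite_fromSpecResidueField_comp f x.2
    have := etale_fromSpecResidueField_comp f x.2
    intersectPts_apply H x.2 y.2 w
  rw [mult_eq_sum, mult_eq_sum]
  simp only [Finsupp.sum, Finset.sum_mul_sum, Finsupp.finsetSum_apply, Finsupp.smul_apply, key]
  refine Finset.sum_congr rfl fun x _ => Finset.sum_congr rfl fun y _ => ?_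
  by_cases h1 : q₁ w = x <;> by_cases h2 : q₂ w = y <;> simp [h1, h2]

end Field

section Ext

variable {k K : Type u} [Field k] [CharZero k] [Field K] {W X : Scheme.{u}} {q₁ : W ⟶ X}
  {q₂ : W ⟶ Spec (.of K)}
  {f : X ⟶ Spec (.of k)} {g : Spec (.of K) ⟶ Spec (.of k)} [LocallyOfFiniteType f]

/-- In the fibre of `X_K ⟶ X` over a closed point every point is a component, and it is reduced
because its local ring has maximal ideal `𝔪_x 𝒪_w + 0`. -/
lemma fibreCycle_apply_of_isPullback (H : IsPullback q₁ q₂ f g) {x : X} (hx : x ∈ closedPoints X)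
    (w : W) [Decidable (q₁ w = x)] :
    fibreCycle q₁ x w = if q₁ w = x then 1 else 0 := by
  classical
  have hfin := isFinite_fromSpecResidueField_comp f hx
  have hE := etale_fromSpecResidueField_comp f hx
  have hS : genericPts (q₁ ⁻¹' {x}) = {w | q₁ w = x} := by
    refine subset_antisymm (fun w hw => hw.1) fun w hw => ⟨hw, fun z hz h => ?_⟩
    obtain rfl := hw
    exact eq_of_specializes_of_isFinite H h hz (Subsingleton.elim _ _)
  have hfin : {w | q₁ w = x}.Finite :=
    (finite_setOf_map_eq H x default).subset fun w hw => ⟨hw, Subsingleton.elim _ _⟩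
  have hone (z : W) (hz : q₁ z = x) : Module.length (W.presheaf.stalk z) (W.presheaf.stalk z ⧸
      (IsLocalRing.maximalIdeal (X.presheaf.stalk (q₁ z))).map (q₁.stalkMap z).hom) = 1 := by
    rw [← hz] at hE
    have h := maximalIdeal_eq_sup H z
    have h2 : IsLocalRing.maximalIdeal ((Spec (.of K)).presheaf.stalk (q₂ z)) = ⊥ :=
      IsLocalRing.isField_iff_maximalIdeal_eq.1 (isField_stalk_Spec K (q₂ z))
    rw [h2, Ideal.map_bot, sup_bot_eq] at h
    rw [← h]
    exact Module.length_eq_one_iff.2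
      (isSimpleModule_iff_isCoatom.2 (IsLocalRing.maximalIdeal.isMaximal _).1)
  rw [fibreCycle, hS, finsum_mem_eq_finite_toFinset_sum _ hfin, Finsupp.finsetSum_apply]
  rw [Finset.sum_congr rfl (g := fun z => if z = w then (1 : ℤ) else 0)]
  · simp
  · intro z hz
    rw [hone z (by simpa using hz), Finsupp.single_apply]
    simp

lemma flatPullback_apply_of_isPullback (H : IsPullback q₁ q₂ f g) (a : Z0 X) (w : W) :
    flatPullback q₁ a w = mult a (q₁ w) := by
  classical
  rw [mult_eq_sum, flatPullback, Finsupp.liftAddHom_apply, Finsupp.sum_apply]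
  refine Finset.sum_congr rfl fun x _ => ?_
  simp [fibreCycle_apply_of_isPullback H x.2]

/-- The pullback of a 0-cycle along an extension of the base field has the same coefficients. -/
lemma mult_zeroDim_flatPullback (H : IsPullback q₁ q₂ f g) (a : Z0 X) (p : W) :
    mult (flatPullback q₁ a).zeroDim p = mult a (q₁ p) := by
  by_cases hp : p ∈ closedPoints W
  · rw [mult_zeroDim _ hp, flatPullback_apply_of_isPullback H]
  · rw [mult_of_notMem _ hp, mult_of_notMem]
    intro h
    have := isFinite_fromSpecResidueField_comp f h
    refine hp (mem_closedPoints_of_isPullback H h ?_)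
    rw [mem_closedPoints_iff]
    exact isClosed_discrete _

end Ext

lemma mult_extCycle {k : Type u} [Field k] [CharZero k] (K : Type u) [Field K] [Algebra k K]
    {V : Scheme.{u}} (s : V ⟶ Spec (.of k)) [LocallyOfFiniteType s] (a : Z0 V) (p : ext K s) :
    mult (extCycle K s a) p =
      mult a (pullback.fst s (Spec.map (CommRingCat.ofHom (algebraMap k K))) p) :=
  mult_zeroDim_flatPullback (IsPullback.of_hasPullback s _) a p

/-! ### Residue degrees and proper pushforward -/

lemma residueDegree_comp {U V W : Scheme.{u}} (f : U ⟶ V) (g : V ⟶ W) (x : U) :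
    (f ≫ g).residueDegree x = g.residueDegree (f x) * f.residueDegree x := by
  let K₁ := W.residueField (g (f x))
  let K₂ := V.residueField (f x)
  let K₃ := U.residueField x
  let a₁ : Algebra K₁ K₂ := (g.residueFieldMap (f x)).hom.toAlgebra
  let a₂ : Algebra K₂ K₃ := (f.residueFieldMap x).hom.toAlgebra
  let a₃ : Algebra K₁ K₃ := ((f ≫ g).residueFieldMap x).hom.toAlgebra
  have : IsScalarTower K₁ K₂ K₃ := IsScalarTower.of_algebraMap_eq fun r => by
    have h := Scheme.residueFieldMap_comp f g x
    exact congr($h r)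
  exact (Module.finrank_mul_finrank K₁ K₂ K₃).symm

lemma residueDegree_eq_one_of_surjective {U V : Scheme.{u}} (f : U ⟶ V) (x : U)
    (h : Function.Surjective (f.stalkMap x).hom) : f.residueDegree x = 1 := by
  have hs : Function.Surjective (f.residueFieldMap x).hom := by
    intro z
    obtain ⟨z, rfl⟩ := IsLocalRing.residue_surjective z
    obtain ⟨z, rfl⟩ := h z
    exact ⟨IsLocalRing.residue _ z, rfl⟩
  let := (f.residueFieldMap x).hom.toAlgebra
  have e : V.residueField (f x) ≃ₗ[V.residueField (f x)] U.residueField x :=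
    LinearEquiv.ofBijective (Algebra.linearMap _ _) ⟨(f.residueFieldMap x).hom.injective, hs⟩
  exact e.finrank_eq.symm.trans (Module.finrank_self _)

lemma residueDegree_of_isPreimmersion {U V : Scheme.{u}} (f : U ⟶ V) [IsPreimmersion f] (x : U) :
    f.residueDegree x = 1 :=
  residueDegree_eq_one_of_surjective f x (f.stalkMap_surjective x)

lemma pushforward_single {V W : Scheme.{u}} (f : V ⟶ W) [IsProper f] (P : closedPoints V) (n : ℤ) :
    pushforward f (Finsupp.single P n) =
      Finsupp.single (imageClosedPoint f P) (n * (f.residueDegree P.1 : ℤ)) := by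
  simp [pushforward]

lemma pushforward_comp {U V W : Scheme.{u}} (f : U ⟶ V) (g : V ⟶ W) [IsProper f] [IsProper g]
    (a : Z0 U) : pushforward (f ≫ g) a = pushforward g (pushforward f a) := by
  induction a using Finsupp.induction_linear with
  | zero => simp
  | add a b ha hb => simp [ha, hb]
  | single P n =>
    rw [pushforward_single, pushforward_single, pushforward_single, residueDegree_comp]
    push_cast
    rw [mul_assoc, mul_comm (f.residueDegree P.1 : ℤ)]
    rfl

/-- The definition of `rationallyTrivial` allows all proper maps from normal curves, so that
functoriality of the pushforward suffices. -/
lemma pushforward_mem_rationallyTrivial {V W : Scheme.{u}} (f : V ⟶ W) [IsProper f] {a : Z0 V}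
    (ha : a ∈ rationallyTrivial V) : pushforward f a ∈ rationallyTrivial W := by
  suffices h : rationallyTrivial V ≤ (rationallyTrivial W).comap (pushforward f) from h ha
  refine (AddSubgroup.closure_le _).2 ?_
  rintro _ ⟨C, hC, hC', p, hp, g, hs, hg, rfl⟩
  refine AddSubgroup.subset_closure ⟨C, hC, hC', p ≫ f, inferInstance, g, hs, hg, ?_⟩
  rw [pushforward_comp]

lemma mult_pushforward {V W : Scheme.{u}} (f : V ⟶ W) [IsProper f] (a : Z0 V) (w : W)
    [DecidableEq W] :
    mult (pushforward f a) w =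
      a.sum fun P n => if f P.1 = w then n * (f.residueDegree P.1 : ℤ) else 0 := by
  induction a using Finsupp.induction_linear with
  | zero => simp [mult]
  | add a b ha hb =>
    rw [map_add, mult_add, ha, hb, Finsupp.sum_add_index']
    · simp
    · intro P n m
      split_ifs <;> ring
  | single P n =>
    rw [pushforward_single, mult_single, Finsupp.sum_single_index (by simp)]
    simp only [imageClosedPoint, eq_comm]; rfl

/-! ### Degrees of points of a finite reduced algebra -/

section

open TensorProduct

/-- The evaluation `R → κ(p)` at a point `p` of `Spec R`. -/
def specEval (R : CommRingCat.{u}) (p : Spec R) : R ⟶ (Spec R).residueField p :=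
  (Scheme.ΓSpecIso R).inv ≫ (Spec R).presheaf.germ ⊤ p trivial ≫ (Spec R).residue p

lemma specEval_naturality {R S : CommRingCat.{u}} (φ : R ⟶ S) (p : Spec S) :
    φ ≫ specEval S p = specEval R (Spec.map φ p) ≫ (Spec.map φ).residueFieldMap p := by
  have h1 := Scheme.Γevaluation_naturality (Spec.map φ) p
  have h2 := Scheme.ΓSpecIso_inv_naturality φ
  have h3 : φ ≫ (Scheme.ΓSpecIso S).inv ≫ (Spec S).Γevaluation p =
    (Scheme.ΓSpecIso R).inv ≫ (Spec R).Γevaluation (Spec.map φ p) ≫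
      (Spec.map φ).residueFieldMap p := by
    rw [h1, reassoc_of% h2]
  exact h3

instance isPrime_asIdeal (R : CommRingCat.{u}) (p : Spec R) : p.asIdeal.IsPrime := p.2

lemma specEval_eq (R : CommRingCat.{u}) (p : Spec R) :
    specEval R p = CommRingCat.ofHom (algebraMap R p.asIdeal.ResidueField) ≫
      (Scheme.Spec.residueFieldIso R p).inv :=
  (Scheme.Spec.algebraMap_residueFieldIso_inv R p).symm

lemma specEval_surjective (R : CommRingCat.{u}) (p : Spec R) [p.asIdeal.IsMaximal] :
    Function.Surjective (specEval R p).hom := by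
  rw [specEval_eq]
  exact (ConcreteCategory.bijective_of_isIso (Scheme.Spec.residueFieldIso R p).inv).2.comp
    (Ideal.algebraMap_residueField_surjective p.asIdeal)

lemma ker_specEval (R : CommRingCat.{u}) (p : Spec R) :
    RingHom.ker (specEval R p).hom = p.asIdeal := by
  rw [specEval_eq]
  have h1 : RingHom.ker (algebraMap R p.asIdeal.ResidueField) = p.asIdeal :=
    Ideal.ker_algebraMap_residueField p.asIdeal
  have h2 := (ConcreteCategory.bijective_of_isIso (Scheme.Spec.residueFieldIso R p).inv).1
  exact (RingHom.ker_comp_of_injective _ h2).trans h1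

/-- The residue degree of a maximal ideal over a field, in terms of rings. -/
lemma residueDegree_SpecMap {L A : Type u} [Field L] [CommRing A] [Algebra L A]
    (p : Spec (.of A)) [p.asIdeal.IsMaximal] :
    (Spec.map (CommRingCat.ofHom (algebraMap L A))).residueDegree p =
      Module.finrank L (A ⧸ p.asIdeal) := by
  let φ : Spec (.of A) ⟶ Spec (.of L) := Spec.map (CommRingCat.ofHom (algebraMap L A))
  let := (φ.residueFieldMap p).hom.toAlgebra
  have hm : (φ p).asIdeal.IsMaximal := by
    have : (φ p).asIdeal = ⊥ := (Ideal.eq_bot_or_top (K := L) (φ p).asIdeal).resolve_right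
      (isPrime_asIdeal (.of L) (φ p)).ne_top
    rw [this]
    exact Ideal.bot_isMaximal
  let e₁ : L ≃+* (Spec (.of L)).residueField (φ p) :=
    RingEquiv.ofBijective (specEval (.of L) (φ p)).hom
      ⟨RingHom.injective _, specEval_surjective (.of L) (φ p)⟩
  let e₂ : A ⧸ p.asIdeal ≃+* (Spec (.of A)).residueField p :=
    (Ideal.quotEquivOfEq (ker_specEval (.of A) p).symm).trans
      (RingHom.quotientKerEquivOfSurjective (specEval_surjective (.of A) p))
  symm
  refine Algebra.finrank_eq_of_equiv_equiv e₁ e₂ ?_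
  ext r
  exact congr($(specEval_naturality (CommRingCat.ofHom (algebraMap L A)) p) r).symm

lemma sum_residueDegree_SpecMap {L A : Type u} [Field L] [CommRing A] [Algebra L A]
    [Module.Finite L A] [IsReduced A] :
    ∑ᶠ p : Spec (.of A), (Spec.map (CommRingCat.ofHom (algebraMap L A))).residueDegree p =
      Module.finrank L A := by
  classical
  have : IsArtinianRing A := IsArtinianRing.of_finite L A
  have hft : Finite (MaximalSpectrum A) := inferInstance
  have := Fintype.ofFinite (MaximalSpectrum A)
  let e : MaximalSpectrum A ≃ Spec (.of A) := IsArtinianRing.primeSpectrumEquivMaximalSpectrum.symm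
  let e' : A ≃ₗ[L] (∀ I : MaximalSpectrum A, A ⧸ I.asIdeal) :=
    (IsArtinianRing.equivPi A).toLinearEquiv.restrictScalars L
  rw [e'.finrank_eq, Module.finrank_pi_fintype, ← finsum_comp_equiv e, finsum_eq_sum_of_fintype]
  refine Finset.sum_congr rfl fun I _ => ?_
  have : (e I).asIdeal.IsMaximal := I.isMaximal
  exact residueDegree_SpecMap (e I)

/-- The residue degrees over `L` of the points of `Spec (L ⊗[k] M)` add up to `[M : k]`: the
tensor product is reduced since `M` is separable over `k`. -/
lemma sum_residueDegree_of_isPullback {k L M : Type u} [Field k] [Field L] [Field M] [CharZero k]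
    [Algebra k L] [Algebra k M] [Module.Finite k M] {G : Scheme.{u}} {a : G ⟶ Spec (.of M)}
    {b : G ⟶ Spec (.of L)}
    (H : IsPullback a b (Spec.map (CommRingCat.ofHom (algebraMap k M)))
      (Spec.map (CommRingCat.ofHom (algebraMap k L)))) :
    ∑ᶠ x : G, b.residueDegree x = Module.finrank k M := by
  have hE : Algebra.FormallyEtale k M := Algebra.FormallyEtale.of_isSeparable k M
  have hE' : Algebra.FormallyUnramified L (L ⊗[k] M) := inferInstance
  have hR : IsReduced (L ⊗[k] M) := Algebra.FormallyUnramified.isReduced_of_field L (L ⊗[k] M)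
  have H' := isPullback_SpecMap_of_isPushout _ _ _ _ (CommRingCat.isPushout_tensorProduct k L M)
  rw [← Module.finrank_baseChange (R := L), ← sum_residueDegree_SpecMap (A := L ⊗[k] M)]
  let e : G ≅ Spec (.of (L ⊗[k] M)) := H.flip.isoIsPullback _ _ H'
  have he : e.hom ≫ Spec.map (CommRingCat.ofHom (algebraMap L (L ⊗[k] M))) = b :=
    H.flip.isoIsPullback_hom_fst _ _ H'
  rw [← finsum_comp_equiv e.hom.homeomorph.toEquiv]
  refine finsum_congr fun x => ?_
  rw [← he, residueDegree_comp, residueDegree_of_isPreimmersion e.hom, mul_one]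
  rfl

end

/-! ### Base change of residue degrees -/

lemma isPullback_of_comp_mono {𝒞 : Type*} [Category 𝒞] {P X Y Z Z' : 𝒞} {a : P ⟶ X} {b : P ⟶ Y}
    {f : X ⟶ Z} {g : Y ⟶ Z} {i : Z ⟶ Z'} [Mono i] (H : IsPullback a b (f ≫ i) (g ≫ i)) :
    IsPullback a b f g := by
  have hw : a ≫ f = b ≫ g := by
    rw [← cancel_mono i, Category.assoc, Category.assoc, H.w]
  refine ⟨⟨hw⟩, ⟨PullbackCone.IsLimit.mk hw
    (fun s => H.lift s.fst s.snd (by rw [reassoc_of% s.condition])) (fun s => H.lift_fst _ _ _)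
    (fun s => H.lift_snd _ _ _) fun s m h1 h2 => ?_⟩⟩
  exact H.hom_ext (h1.trans (H.lift_fst _ _ _).symm) (h2.trans (H.lift_snd _ _ _).symm)

/-- For `D = C ×_X X'`, the residue degrees over `X'` of the points of `D` over `c` and `x` add up
to the residue degree of `c` over `X`: these points are those of the scheme `G` below, which is
`Spec κ(c) ×_{κ(f c)} Spec κ(x)`. -/
lemma sum_residueDegree_eq {D C X X' : Scheme.{u}} {ρ : D ⟶ C} {h : D ⟶ X'} {f : C ⟶ X}
    {π : X' ⟶ X} (H : IsPullback ρ h f π) {c : C} {x : X'} (hx : π x = f c)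
    (hk : CharZero (X.residueField (f c)))
    (hfin : (f.residueFieldMap c).hom.Finite) :
    ∑ᶠ d : {d : D | ρ d = c ∧ h d = x}, h.residueDegree d.1 = f.residueDegree c := by
  let F := ρ.fiber c
  let e : F ⟶ X' := ρ.fiberι c ≫ h
  have H1 : IsPullback e (ρ.fiberToSpecResidueField c) π (C.fromSpecResidueField c ≫ f) :=
    isPullback_fiber H c
  let G := e.fiber x
  have H2 : IsPullback (e.fiberι x ≫ ρ.fiberToSpecResidueField c) (e.fiberToSpecResidueField x)
      (C.fromSpecResidueField c ≫ f) (X'.fromSpecResidueField x ≫ π) := isPullback_fiber H1 x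
  -- the extension `κ(f c) = κ(π x) → κ(x)`
  let θ : X.residueField (f c) ⟶ X'.residueField x :=
    (X.residueFieldCongr hx.symm).hom ≫ π.residueFieldMap x
  have hθ : X'.fromSpecResidueField x ≫ π = Spec.map θ ≫ X.fromSpecResidueField (f c) := by
    rw [← Scheme.Hom.SpecMap_residueFieldMap_fromSpecResidueField, Spec.map_comp, Category.assoc,
      Scheme.residueFieldCongr_fromSpecResidueField]
  rw [hθ, ← Scheme.Hom.SpecMap_residueFieldMap_fromSpecResidueField] at H2
  have H3 : IsPullback (e.fiberι x ≫ ρ.fiberToSpecResidueField c) (e.fiberToSpecResidueField x)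
      (Spec.map (f.residueFieldMap c)) (Spec.map θ) := by
    exact isPullback_of_comp_mono H2
  let := (f.residueFieldMap c).hom.toAlgebra
  let := θ.hom.toAlgebra
  have : Module.Finite (X.residueField (f c)) (C.residueField c) := hfin
  have key := sum_residueDegree_of_isPullback (k := X.residueField (f c)) (L := X'.residueField x)
    (M := C.residueField c) H3
  let ι : G ⟶ D := e.fiberι x ≫ ρ.fiberι c
  have hι : ι ≫ h = e.fiberToSpecResidueField x ≫ X'.fromSpecResidueField x := by
    have h1 : e.fiberι x ≫ e = e.fiberToSpecResidueField x ≫ X'.fromSpecResidueField x :=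
      pullback.condition
    exact (Category.assoc _ _ _).trans h1
  have h1 (g : G) : ρ (ι g) = c := map_fiberι_apply ρ c (e.fiberι x g)
  have h2 (g : G) : h (ι g) = x := map_fiberι_apply e x g
  let j : G → {d : D | ρ d = c ∧ h d = x} := fun g => ⟨ι g, h1 g, h2 g⟩
  have hj : Function.Bijective j := by
    constructor
    · intro a b hab
      exact ι.isEmbedding.injective (congrArg Subtype.val hab)
    · rintro ⟨d, hd1, hd2⟩
      obtain ⟨d, rfl⟩ := exists_fiberι_apply_eq ρ hd1
      obtain ⟨d, rfl⟩ := exists_fiberι_apply_eq e hd2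
      exact ⟨d, rfl⟩
  have h5 : f.residueDegree c = Module.finrank (X.residueField (f c)) (C.residueField c) := rfl
  rw [h5, ← key]
  symm
  refine finsum_eq_of_bijective j hj fun g => ?_
  have h3 := residueDegree_comp ι h g
  rw [residueDegree_of_isPreimmersion ι, mul_one] at h3
  have h4 := residueDegree_comp (e.fiberToSpecResidueField x) (X'.fromSpecResidueField x) g
  rw [residueDegree_of_isPreimmersion (X'.fromSpecResidueField x), one_mul, ← hι, h3] at h4
  exact h4.symm

/-! ### Base change of pushforwards of 0-cycles -/

/-- The sum ranges over all points of the fibre; those that are not closed contribute zero. -/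
lemma mult_pushforward_eq_finsum {V W : Scheme.{u}} (f : V ⟶ W) [IsProper f] (a : Z0 V) (w : W) :
    mult (pushforward f a) w = ∑ᶠ v ∈ f ⁻¹' {w}, mult a v * (f.residueDegree v : ℤ) := by
  classical
  have h0 : mult (pushforward f a) w = (a.mapDomain Subtype.val).sum fun v n =>
      if f v = w then n * (f.residueDegree v : ℤ) else 0 := by
    rw [mult_pushforward, Finsupp.sum_mapDomain_index (fun v => by simp)]
    intro v n m
    split_ifs <;> ring
  rw [h0, Finsupp.sum, ← finsum_eq_sum_of_support_subset]
  · refine finsum_congr fun v => ?_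
    rw [finsum_eq_if]
    rfl
  · intro v hv
    simp only [Function.mem_support] at hv
    simp only [Finset.mem_coe, Finsupp.mem_support_iff]
    intro h
    simp [h] at hv

lemma finite_residueFieldMap {k : Type u} [Field k] {C X : Scheme.{u}} (f : C ⟶ X)
    (s : X ⟶ Spec (.of k)) [LocallyOfFiniteType (f ≫ s)] {c : C} (hc : c ∈ closedPoints C) :
    (f.residueFieldMap c).hom.Finite := by
  rw [← IsFinite.SpecMap_iff]
  have h1 := isFinite_fromSpecResidueField_comp (f ≫ s) hc
  rw [← Category.assoc, ← Scheme.Hom.SpecMap_residueFieldMap_fromSpecResidueField,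
    Category.assoc] at h1
  have : IsSeparated (X.fromSpecResidueField (f c) ≫ s) := by
    obtain ⟨ψ, hψ⟩ := Spec.map_surjective (X.fromSpecResidueField (f c) ≫ s)
    rw [← hψ]
    infer_instance
  exact MorphismProperty.of_postcomp (W := @IsFinite) (W' := @IsSeparated) _
    (X.fromSpecResidueField (f c) ≫ s) this h1

section FieldExtension

variable {k L : Type u} [Field k] [CharZero k] [Field L] {X X' : Scheme.{u}} {π : X' ⟶ X}
  {t : X' ⟶ Spec (.of L)} {s : X ⟶ Spec (.of k)} {φ : Spec (.of L) ⟶ Spec (.of k)}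

lemma charZero_residueField (s : X ⟶ Spec (.of k)) (x : X) : CharZero (X.residueField x) :=
  charZero_of_injective_ringHom (RingHom.injective
    (Spec.preimage (X.fromSpecResidueField x ≫ s)).hom)

variable [LocallyOfFiniteType s]

/-- Extension of the base field commutes with proper pushforward. -/
lemma flatPullback_pushforward (H : IsPullback π t s φ) {C D : Scheme.{u}} {ρ : D ⟶ C}
    {h : D ⟶ X'} {f : C ⟶ X} [IsProper f] [IsProper h] (H' : IsPullback ρ h f π) (a : Z0 C) :
    (flatPullback π (pushforward f a)).zeroDim = pushforward h (flatPullback ρ a).zeroDim := by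
  have H₂ : IsPullback ρ (h ≫ t) (f ≫ s) φ := H'.flip.paste_horiz H.flip |>.flip
  refine ext_mult fun x => ?_
  rw [mult_zeroDim_flatPullback H, mult_pushforward_eq_finsum h]
  simp only [mult_zeroDim_flatPullback H₂]
  induction a using Finsupp.induction_linear with
  | zero => simp [mult]
  | add a b ha hb =>
    have hfin (a : Z0 C) : Set.Finite (h ⁻¹' {x} ∩
        Function.support fun d => mult a (ρ d) * (h.residueDegree d : ℤ)) := by
      refine ((finite_mult (flatPullback ρ a).zeroDim)).subset ?_
      rintro d ⟨-, hd⟩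
      change mult _ d ≠ 0
      rw [mult_zeroDim_flatPullback H₂]
      exact left_ne_zero_of_mul hd
    simp only [map_add, mult_add, ha, hb, add_mul]
    rw [finsum_mem_add_distrib' (hfin a) (hfin b)]
  | single c n =>
    rw [pushforward_single]
    have h1 : ∑ᶠ d ∈ h ⁻¹' {x}, mult (Finsupp.single c n) (ρ d) * (h.residueDegree d : ℤ) =
        ∑ᶠ d ∈ {d | ρ d = c.1 ∧ h d = x}, n * (h.residueDegree d : ℤ) := by
      refine finsum_congr fun d => ?_
      by_cases hd : h d = x
      · by_cases hc : ρ d = c.1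
        · simp [hd, hc, mult_single_eq]
        · simp [hc, mult_single_of_ne]
      · simp [hd]
    rw [h1]
    by_cases hx : π x = f c.1
    · rw [mult_single_eq _ _ _ hx]
      have hs : {d | ρ d = c.1 ∧ h d = x}.Finite := by
        have := isFinite_fromSpecResidueField_comp (f ≫ s) c.2
        refine (finite_setOf_map_eq H₂ c.1 default).subset ?_
        rintro d ⟨h1, -⟩
        exact ⟨h1, Subsingleton.elim _ _⟩
      have h2 := sum_residueDegree_eq H' hx (charZero_residueField s _)
        (finite_residueFieldMap f s c.2)
      rw [finsum_set_coe_eq_finsum_mem (f := fun d => h.residueDegree d)] at h2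
      rw [← h2]
      exact ((AddMonoidHom.mulLeft n).comp (Nat.castAddMonoidHom ℤ)).map_finsum_mem _ hs
    · rw [mult_single_of_ne _ _ _ hx]
      symm
      refine finsum_mem_of_eqOn_zero ?_
      rintro d ⟨h1, h2⟩
      refine absurd ?_ hx
      have := congr(($H'.w : D ⟶ X) d)
      rw [← h1, ← h2]
      exact this.symm

end FieldExtension

/-! ### Unramified extensions of discrete valuation rings -/

section DVR

/-- By Krull's intersection theorem every nonzero element is a unit times a power of `ϖ`. -/
lemma isDomain_and_isDVR_of_maximalIdeal_eq_span {B : Type u} [CommRing B] [IsNoetherianRing B]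
    [IsLocalRing B] {ϖ : B} (h : IsLocalRing.maximalIdeal B = Ideal.span {ϖ})
    (hϖ : ϖ ∈ nonZeroDivisors B) : ∃ _ : IsDomain B, IsDiscreteValuationRing B := by
  have hm : ϖ ∈ IsLocalRing.maximalIdeal B := h ▸ Ideal.mem_span_singleton_self ϖ
  have key (x : B) (hx : x ≠ 0) : ∃ (n : ℕ) (c : B), IsUnit c ∧ x = ϖ ^ n * c := by
    have hfin : FiniteMultiplicity ϖ x := by
      by_contra hcon
      apply hx
      have h1 : x ∈ ⨅ n : ℕ, IsLocalRing.maximalIdeal B ^ n := by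
        rw [Ideal.mem_iInf]
        intro n
        rw [h, Ideal.span_singleton_pow, Ideal.mem_span_singleton]
        rw [FiniteMultiplicity.not_iff_forall] at hcon
        exact hcon n
      rwa [Ideal.iInf_pow_eq_bot_of_isLocalRing _ (Ideal.IsPrime.ne_top inferInstance),
        Ideal.mem_bot] at h1
    obtain ⟨c, hc, hd⟩ := hfin.exists_eq_pow_mul_and_not_dvd
    refine ⟨_, c, ?_, hc⟩
    by_contra hcu
    exact hd (Ideal.mem_span_singleton.1 (h ▸ (IsLocalRing.mem_maximalIdeal c).2 hcu))
  have hnzd (x : B) (hx : x ≠ 0) : x ∈ nonZeroDivisors B := by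
    obtain ⟨n, c, hc, rfl⟩ := key x hx
    exact mul_mem (pow_mem hϖ n) hc.mem_nonZeroDivisors
  have hdom : IsDomain B := by
    have : NoZeroDivisors B := ⟨fun {a b} hab => by
      by_contra! hne
      exact hne.1 ((mem_nonZeroDivisors_iff_right.1 (hnzd b hne.2)) a hab)⟩
    exact NoZeroDivisors.to_isDomain B
  have hf : ¬ IsField B := fun hF => by
    rw [IsLocalRing.isField_iff_maximalIdeal_eq] at hF
    rw [hF, Ideal.mem_bot] at hm
    exact nonZeroDivisors.ne_zero hϖ hm
  exact ⟨hdom, ((IsDiscreteValuationRing.TFAE B hf).out 0 4).2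
    (⟨⟨ϖ, h⟩⟩ : (IsLocalRing.maximalIdeal B).IsPrincipal)⟩

/-- A flat unramified local extension of a discrete valuation ring is one: flatness makes the
uniformizer a nonzerodivisor. -/
lemma isDomain_and_isDVR_of_flat {A B : Type u} [CommRing A] [IsDomain A]
    [IsDiscreteValuationRing A] [CommRing B] [IsNoetherianRing B] [IsLocalRing B] (φ : A →+* B)
    (hφ : φ.Flat)
    (h : (IsLocalRing.maximalIdeal A).map φ = IsLocalRing.maximalIdeal B) :
    ∃ _ : IsDomain B, IsDiscreteValuationRing B := by
  obtain ⟨ϖ, hϖ⟩ := IsDiscreteValuationRing.exists_irreducible A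
  refine isDomain_and_isDVR_of_maximalIdeal_eq_span (ϖ := φ ϖ) ?_ ?_
  · rw [← h, hϖ.maximalIdeal_eq, Ideal.map_span, Set.image_singleton]
  · algebraize [φ]
    have h1 : IsSMulRegular B ϖ :=
      Module.Flat.isSMulRegular_of_nonZeroDivisors (mem_nonZeroDivisors_of_ne_zero hϖ.ne_zero)
    rw [mem_nonZeroDivisors_iff_right]
    intro x hx
    refine h1 ?_
    simp only [Algebra.smul_def, mul_zero]
    rw [mul_comm]
    exact hx

/-- A uniformizer stays a uniformizer, so orders of vanishing do not change. -/
lemma ordFrac_map {A B K L : Type u} [CommRing A] [IsDomain A] [IsDiscreteValuationRing A]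
    [CommRing B] [IsDomain B] [IsDiscreteValuationRing B] [Field K] [Field L] [Algebra A K]
    [IsFractionRing A K] [Algebra B L] [IsFractionRing B L] (φ : A →+* B) (ψ : K →+* L)
    (hψ : ∀ a, ψ (algebraMap A K a) = algebraMap B L (φ a))
    (h : (IsLocalRing.maximalIdeal A).map φ = IsLocalRing.maximalIdeal B) (x : K) :
    Ring.ordFrac B (ψ x) = Ring.ordFrac A x := by
  obtain ⟨ϖ, hϖ⟩ := IsDiscreteValuationRing.exists_irreducible A
  have hϖ' : Irreducible (φ ϖ) := by
    rw [IsDiscreteValuationRing.irreducible_iff_uniformizer, ← h, hϖ.maximalIdeal_eq,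
      Ideal.map_span, Set.image_singleton]
  have key (a : A) : Ring.ordFrac B (ψ (algebraMap A K a)) = Ring.ordFrac A (algebraMap A K a) := by
    by_cases ha : a = 0
    · simp [ha]
    obtain ⟨n, c, rfl⟩ := IsDiscreteValuationRing.eq_unit_mul_pow_irreducible ha hϖ
    rw [hψ]
    simp only [map_mul, map_pow]
    rw [Ring.ordFrac_irreducible hϖ, Ring.ordFrac_irreducible hϖ', Ring.ordFrac_of_isUnit c.isUnit,
      Ring.ordFrac_of_isUnit (c.isUnit.map φ)]
  obtain ⟨a, b, -, rfl⟩ := IsFractionRing.div_surjective (A := A) x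
  rw [map_div₀, map_div₀, map_div₀, key, key]

end DVR

lemma coheight_eq_one_of_isDVR {C : Scheme.{u}} (c : C) [IsDomain (C.presheaf.stalk c)]
    [IsDiscreteValuationRing (C.presheaf.stalk c)] : Order.coheight c = 1 := by
  rw [coheight_eq_height]
  have h1 := IsLocalRing.maximalIdeal_height_eq_ringKrullDim (R := C.presheaf.stalk c)
  rw [IsDiscreteValuationRing.ringKrullDim_eq_one] at h1
  exact_mod_cast h1

/-- The homomorphism of function fields induced by a dominant morphism of integral schemes. The
specialization map identifies the stalks at the two names `genericPoint C` and
`φ (genericPoint U)` of the same point. -/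
def functionFieldMap {U C : Scheme.{u}} [IsIntegral U] [IsIntegral C] (φ : U ⟶ C)
    (h : φ (genericPoint U) = genericPoint C) : C.functionField ⟶ U.functionField :=
  C.presheaf.stalkSpecializes (specializes_of_eq h) ≫ φ.stalkMap (genericPoint U)

lemma functionFieldMap_algebraMap {U C : Scheme.{u}} [IsIntegral U] [IsIntegral C] (φ : U ⟶ C)
    (h : φ (genericPoint U) = genericPoint C) (p : U) (a : C.presheaf.stalk (φ p)) :
    functionFieldMap φ h (algebraMap _ C.functionField a) =
      algebraMap (U.presheaf.stalk p) U.functionField (φ.stalkMap p a) := by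
  have h1 := Scheme.Hom.stalkSpecializes_stalkMap φ _ _ (genericPoint_specializes p)
  have h2 : C.presheaf.stalkSpecializes (genericPoint_specializes (φ p)) ≫
      C.presheaf.stalkSpecializes (specializes_of_eq h) =
      C.presheaf.stalkSpecializes ((genericPoint_specializes p).map φ.continuous) :=
    TopCat.Presheaf.stalkSpecializes_comp _ _ _
  have h3 : C.presheaf.stalkSpecializes (genericPoint_specializes (φ p)) ≫
      functionFieldMap φ h = φ.stalkMap p ≫
        U.presheaf.stalkSpecializes (genericPoint_specializes p) := by
    rw [functionFieldMap, reassoc_of% h2]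
    exact h1
  exact congr($h3 a)

lemma ord_functionFieldMap {U C : Scheme.{u}} [IsIntegral U] [IsIntegral C]
    [IsLocallyNoetherian U] [IsLocallyNoetherian C] (φ : U ⟶ C)
    (h : φ (genericPoint U) = genericPoint C) (p : U)
    [IsDiscreteValuationRing (U.presheaf.stalk p)]
    [IsDiscreteValuationRing (C.presheaf.stalk (φ p))]
    (hm : (IsLocalRing.maximalIdeal (C.presheaf.stalk (φ p))).map (φ.stalkMap p).hom =
      IsLocalRing.maximalIdeal (U.presheaf.stalk p)) (g : C.functionField) :
    U.ord (functionFieldMap φ h g) p = C.ord g (φ p) := by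
  have h1 : Order.coheight p = 1 := coheight_eq_one_of_isDVR p
  have h2 : Order.coheight (φ p) = 1 := coheight_eq_one_of_isDVR (φ p)
  rw [Scheme.ord_eq_ordHom_of_coheight_eq_one h1, Scheme.ord_eq_ordHom_of_coheight_eq_one h2]
  have := ordFrac_map (A := C.presheaf.stalk (φ p)) (B := U.presheaf.stalk p)
    (φ.stalkMap p).hom (functionFieldMap φ h).hom (functionFieldMap_algebraMap φ h p) hm g
  have h3 : U.ordHom p h1 (functionFieldMap φ h g) = C.ordHom (φ p) h2 g := this
  rw [h3]

/-! ### Normal curves -/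

section

open TopologicalSpace

section Curve

variable {C : Scheme.{u}}

/-- A point specializes to a closed point, which has codimension one. -/
lemma isClosed_or_eq_genericPoint [IsIntegral C] [CompactSpace C]
    (hC : ∀ P ∈ closedPoints C, IsDiscreteValuationRing (C.presheaf.stalk P)) (c : C) :
    c ∈ closedPoints C ∨ c = genericPoint C := by
  obtain ⟨p, hp, hpc⟩ := IsClosed.exists_closed_singleton (isClosed_closure (s := {c}))
    ⟨c, subset_closure rfl⟩
  have hcp : c ⤳ p := specializes_iff_mem_closure.2 hp
  have := hC p hpc
  by_cases hne : c = p
  · exact .inl (hne ▸ hpc)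
  right
  have h1 : Order.coheight p = 1 := coheight_eq_one_of_isDVR p
  have hlt : p < c := lt_iff_le_not_ge.2 ⟨hcp, fun h => hne (hcp.antisymm h).eq⟩
  have h2 : Order.coheight c + 1 ≤ 1 := h1 ▸ Order.coheight_add_one_le hlt
  have h3 : Order.coheight c = 0 := by
    generalize Order.coheight c = m at h2
    cases m with
    | top => simp at h2
    | coe m =>
      norm_cast at h2 ⊢
      omega
  have h4 := Order.coheight_eq_zero.1 h3
  have h5 : c ≤ genericPoint C := genericPoint_specializes c
  exact (Specializes.antisymm (h4 h5) (genericPoint_specializes c)).eq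

lemma finite_compl_of_isOpen [IsIntegral C] [IsNoetherian C]
    (hC : ∀ P ∈ closedPoints C, IsDiscreteValuationRing (C.presheaf.stalk P)) (U : C.Opens)
    (hU : Nonempty U) : (U : Set C)ᶜ.Finite := by
  obtain ⟨S, hS, hcl, hirr, hUS⟩ := NoetherianSpace.exists_finite_set_isClosed_irreducible
    (U.isOpen.isClosed_compl)
  rw [hUS]
  refine hS.sUnion fun Z hZ => ?_
  obtain ⟨z, hz⟩ := QuasiSober.sober (hirr Z hZ) (hcl Z hZ)
  have hzU : z ∉ U := by
    have : z ∈ (U : Set C)ᶜ := hUS ▸ ⟨Z, hZ, hz.mem⟩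
    exact this
  rcases isClosed_or_eq_genericPoint hC z with h | h
  · rw [← hz.def, IsClosed.closure_eq (mem_closedPoints_iff.1 h)]
    exact Set.finite_singleton z
  · refine absurd ?_ hzU
    rw [h]
    obtain ⟨u⟩ := hU
    exact (genericPoint_specializes u.1).mem_open U.isOpen u.2

/-- The sum defining the divisor of `g` is finite, since `g` is a unit on a nonempty open subset;
so the coefficients of the divisor are the orders of vanishing. -/
lemma mult_divisor [IsIntegral C] [IsNoetherian C]
    (hC : ∀ P ∈ closedPoints C, IsDiscreteValuationRing (C.presheaf.stalk P))
    {g : C.functionField} (hg : g ≠ 0) {P : C} (hP : P ∈ closedPoints C) :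
    mult (divisor C g) P = C.ord g P := by
  have hfin : {P : closedPoints C | C.ord g P.1 ≠ 0}.Finite := by
    obtain ⟨U, -, g, hU, rfl, hgu⟩ := exists_isUnit_germ_eq C g hg
    refine Set.Finite.of_finite_image (f := Subtype.val) ?_ Subtype.val_injective.injOn
    refine (finite_compl_of_isOpen hC U hU).subset ?_
    rintro _ ⟨P, hP, rfl⟩ hPU
    exact hP (Scheme.ord_of_isUnit hgu hPU)
  have h2 : (Function.support fun P : closedPoints C =>
      (Finsupp.single P (C.ord g P.1) : Z0 C)).Finite := by
    refine hfin.subset fun P hP h0 => hP ?_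
    simp only [h0, Finsupp.single_zero]
  have h3 : (divisor C g) ⟨P, hP⟩ = C.ord g P := by
    rw [divisor]
    change Finsupp.applyAddHom (⟨P, hP⟩ : closedPoints C) _ = _
    rw [AddMonoidHom.map_finsum _ h2]
    rw [finsum_eq_single _ ⟨P, hP⟩]
    · simp
    · intro Q hQ
      simp [hQ]
  rw [← h3]
  exact mult_coe _ ⟨P, hP⟩

end Curve

end

/-! ### Schemes whose local rings are domains -/

section

open TopologicalSpace

section Components

variable {D : Scheme.{u}}

/-- If the local ring at `p` is a domain, its zero ideal gives a largest generization of `p`. -/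
lemma specializes_of_isDomain_stalk {p : D} [IsDomain (D.presheaf.stalk p)] :
    ∃ w : D, w ⤳ p ∧ ∀ z, z ⤳ p → w ⤳ z := by
  let b : Spec (D.presheaf.stalk p) := (⊥ : PrimeSpectrum (D.presheaf.stalk p))
  have hb (q : Spec (D.presheaf.stalk p)) : b ⤳ q :=
    (PrimeSpectrum.le_iff_specializes (⊥ : PrimeSpectrum (D.presheaf.stalk p)) q).1 bot_le
  have key (z : D) (hz : z ⤳ p) : D.fromSpecStalk p b ⤳ z := by
    have : z ∈ Set.range (D.fromSpecStalk p) := by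
      rw [Scheme.range_fromSpecStalk]
      exact hz
    obtain ⟨q, rfl⟩ := this
    exact (hb q).map (D.fromSpecStalk p).continuous
  refine ⟨_, ?_, key⟩
  have : D.fromSpecStalk p b ∈ Set.range (D.fromSpecStalk p) := ⟨b, rfl⟩
  rw [Scheme.range_fromSpecStalk] at this
  exact this

lemma eq_of_mem_irreducibleComponents (p : D) [IsDomain (D.presheaf.stalk p)] {Z Z' : Set D}
    (hZ : Z ∈ irreducibleComponents D) (hZ' : Z' ∈ irreducibleComponents D) (hp : p ∈ Z)
    (hp' : p ∈ Z') : Z = Z' := by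
  obtain ⟨w, hw, hw'⟩ := specializes_of_isDomain_stalk (p := p)
  have key (Z : Set D) (hZ : Z ∈ irreducibleComponents D) (hp : p ∈ Z) : Z = closure {w} := by
    obtain ⟨z, hz⟩ := QuasiSober.sober hZ.1 (isClosed_of_mem_irreducibleComponents Z hZ)
    have h1 : w ⤳ z := hw' z (specializes_iff_mem_closure.2 (hz.def ▸ hp))
    have h2 : Z ⊆ closure {w} := by
      rw [← hz.def]
      exact closure_minimal (Set.singleton_subset_iff.2 h1.mem_closure) isClosed_closure
    exact h2.antisymm (hZ.2 (isIrreducible_singleton.closure) h2)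
  rw [key Z hZ hp, key Z' hZ' hp']

/-- If all local rings are domains, each point lies on a single irreducible component, so the
irreducible components are open. -/
lemma isOpen_of_mem_irreducibleComponents [IsNoetherian D]
    (hD : ∀ p : D, IsDomain (D.presheaf.stalk p)) {Z : Set D} (hZ : Z ∈ irreducibleComponents D) :
    IsOpen Z := by
  have h : Z = (D.irreducibleComponentOpen Z : Set D) := by
    ext p
    have := hD p
    simp only [Scheme.irreducibleComponentOpen, Opens.coe_mk, Set.mem_compl_iff, Set.mem_sUnion,
      not_exists, not_and]
    constructor
    · rintro hp Z' hZ' hp'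
      exact hZ'.2 (eq_of_mem_irreducibleComponents p hZ'.1 hZ hp' hp)
    · intro hp
      by_contra hpZ
      refine hp (irreducibleComponent p) ⟨irreducibleComponent_mem_irreducibleComponents p, ?_⟩
        mem_irreducibleComponent
      rintro rfl
      exact hpZ mem_irreducibleComponent
  rw [h]
  exact (D.irreducibleComponentOpen Z).isOpen

lemma isIntegral_of_mem_irreducibleComponents
    (hD : ∀ p : D, IsDomain (D.presheaf.stalk p)) (U : D.Opens)
    (hU : (U : Set D) ∈ irreducibleComponents D) : IsIntegral U := by
  have hred : IsReduced D := by
    have (p : D) : _root_.IsReduced (D.presheaf.stalk p) :=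
      have := hD p
      inferInstance
    exact isReduced_of_isReduced_stalk D
  have h1 : IrreducibleSpace (U : Set D) := Subtype.irreducibleSpace hU.1
  have h2 : IrreducibleSpace U := h1
  have h3 : IsReduced U := inferInstance
  exact isIntegral_of_irreducibleSpace_of_isReduced U

lemma isProper_ι_of_isClosed (U : D.Opens) (hU : IsClosed (U : Set D)) : IsProper U.ι := by
  have : IsClosedImmersion U.ι := .of_isPreimmersion _ (by simpa using hU)
  infer_instance

lemma mult_pushforward_apply {U : Scheme.{u}} (i : U ⟶ D) [IsPreimmersion i] [IsProper i]
    (a : Z0 U) (p : U) : mult (pushforward i a) (i p) = mult a p := by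
  rw [mult_pushforward_eq_finsum]
  have : i ⁻¹' {i p} = {p} := by
    ext q
    exact i.isEmbedding.injective.eq_iff
  rw [this, finsum_mem_singleton, residueDegree_of_isPreimmersion, Nat.cast_one, mul_one]

lemma mult_pushforward_of_notMem_range {U : Scheme.{u}} (i : U ⟶ D) [IsProper i]
    (a : Z0 U) {p : D} (hp : p ∉ Set.range i) : mult (pushforward i a) p = 0 := by
  rw [mult_pushforward_eq_finsum]
  have : i ⁻¹' {p} = ∅ := by
    ext q
    simp only [Set.mem_preimage, Set.mem_singleton_iff, Set.mem_empty_iff_false, iff_false]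
    rintro rfl
    exact hp ⟨q, rfl⟩
  rw [this, finsum_mem_empty]

end Components

end

/-! ### Rational equivalence and finite extension of the base field -/

section

open TopologicalSpace

section FiniteExtension

variable {k L : Type u} [Field k] [CharZero k] [Field L] {C D : Scheme.{u}} {ρ : D ⟶ C}
  {t : D ⟶ Spec (.of L)} {s : C ⟶ Spec (.of k)} {φ : Spec (.of L) ⟶ Spec (.of k)}

/-- A finite extension of the base field is unramified. -/
lemma map_maximalIdeal_of_isPullback [LocallyOfFiniteType φ] (H : IsPullback ρ t s φ) (d : D) :
    (IsLocalRing.maximalIdeal (C.presheaf.stalk (ρ d))).map (ρ.stalkMap d).hom =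
      IsLocalRing.maximalIdeal (D.presheaf.stalk d) := by
  have hE : Etale ((Spec (.of L)).fromSpecResidueField (t d) ≫ φ) :=
    etale_fromSpecResidueField_comp φ (mem_closedPoints_iff.2 (isClosed_discrete _))
  have h := maximalIdeal_eq_sup H.flip d
  have h2 : IsLocalRing.maximalIdeal ((Spec (.of L)).presheaf.stalk (t d)) = ⊥ :=
    IsLocalRing.isField_iff_maximalIdeal_eq.1 (isField_stalk_Spec L (t d))
  rw [h2, Ideal.map_bot, bot_sup_eq] at h
  exact h.symm

lemma isDVR_stalk_of_isPullback [LocallyOfFiniteType φ] [IsIntegral C]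
    (H : IsPullback ρ t s φ) [IsLocallyNoetherian D] {d : D}
    [IsDiscreteValuationRing (C.presheaf.stalk (ρ d))] :
    ∃ _ : IsDomain (D.presheaf.stalk d), IsDiscreteValuationRing (D.presheaf.stalk d) := by
  have hF : Flat ρ := MorphismProperty.of_isPullback H.flip (inferInstance : Flat φ)
  exact isDomain_and_isDVR_of_flat (ρ.stalkMap d).hom (Flat.stalkMap ρ d)
    (map_maximalIdeal_of_isPullback H d)

variable [IsFinite φ] [IsIntegral C] [IsNoetherian C]

lemma isDomain_stalk_of_isPullback (H : IsPullback ρ t s φ) [IsLocallyNoetherian D]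
    (hC : ∀ P ∈ closedPoints C, IsDiscreteValuationRing (C.presheaf.stalk P)) (d : D) :
    IsDomain (D.presheaf.stalk d) := by
  rcases isClosed_or_eq_genericPoint hC (ρ d) with h | h
  · have := hC _ h
    exact (isDVR_stalk_of_isPullback H).1
  · have h1 : IsField (C.presheaf.stalk (ρ d)) := by
      rw [h]
      exact Field.toIsField C.functionField
    have h2 := map_maximalIdeal_of_isPullback H d
    rw [IsLocalRing.isField_iff_maximalIdeal_eq.1 h1, Ideal.map_bot] at h2
    exact (IsLocalRing.isField_iff_maximalIdeal_eq.2 h2.symm).isDomain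

lemma map_genericPoint_of_flat {U C : Scheme.{u}} [IsIntegral U] [IsIntegral C] (φ : U ⟶ C)
    [Flat φ] : φ (genericPoint U) = genericPoint C := by
  obtain ⟨x, hx, hx'⟩ := Flat.generalizingMap φ (genericPoint_specializes (φ (genericPoint U)))
  have h1 : x = genericPoint U := (hx.antisymm (genericPoint_specializes x)).eq
  rw [← hx', h1]

/-- The contribution of an irreducible component `Z` of `D` to the pullback of `div g` is the
pushforward of the divisor of `g` on the normal curve `Z`. -/
lemma exists_rationallyTrivial_of_component (H : IsPullback ρ t s φ) [IsNoetherian D]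
    (hC : ∀ P ∈ closedPoints C, IsDiscreteValuationRing (C.presheaf.stalk P))
    {g : C.functionField} (hg : g ≠ 0) {Z : Set D} (hZ : Z ∈ irreducibleComponents D) :
    ∃ b ∈ rationallyTrivial D, (∀ p ∈ closedPoints D, p ∈ Z → mult b p = C.ord g (ρ p)) ∧
      ∀ p ∉ Z, mult b p = 0 := by
  have hρ : IsFinite ρ := MorphismProperty.of_isPullback H.flip (inferInstance : IsFinite φ)
  have hF : Flat ρ := MorphismProperty.of_isPullback H.flip (inferInstance : Flat φ)
  have hD := isDomain_stalk_of_isPullback H hC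
  let U : D.Opens := ⟨Z, isOpen_of_mem_irreducibleComponents hD hZ⟩
  have hU : IsIntegral U := isIntegral_of_mem_irreducibleComponents hD U hZ
  have hp : IsProper U.ι := isProper_ι_of_isClosed U (isClosed_of_mem_irreducibleComponents Z hZ)
  have hUn : IsNoetherian U :=
    have : IsLocallyNoetherian U := inferInstance
    have : CompactSpace U := QuasiCompact.compactSpace_of_compactSpace U.ι
    ⟨⟩
  let ψ : U.toScheme ⟶ C := U.ι ≫ ρ
  have hψ := map_genericPoint_of_flat ψ
  have hm (p : U.toScheme) : (IsLocalRing.maximalIdeal (C.presheaf.stalk (ψ p))).map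
      (ψ.stalkMap p).hom = IsLocalRing.maximalIdeal (U.toScheme.presheaf.stalk p) := by
    have h1 : ψ.stalkMap p = ρ.stalkMap (U.ι p) ≫ U.ι.stalkMap p :=
      Scheme.Hom.stalkMap_comp U.ι ρ p
    have h2 := map_maximalIdeal_of_isPullback H (U.ι p)
    have h3 := IsLocalRing.map_maximalIdeal_of_surjective (U.ι.stalkMap p).hom
      (U.ι.stalkMap_surjective p)
    rw [← h3, ← h2, Ideal.map_map, h1]
    rfl
  have hcl (p : U.toScheme) (hp : p ∈ closedPoints U.toScheme) : ψ p ∈ closedPoints C :=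
    (imageClosedPoint ψ ⟨p, hp⟩).2
  have hdvr (p : U.toScheme) (hp : p ∈ closedPoints U.toScheme) :
      IsDiscreteValuationRing (U.toScheme.presheaf.stalk p) := by
    have := hC _ (hcl p hp)
    exact (isDomain_and_isDVR_of_flat (ψ.stalkMap p).hom (Flat.stalkMap ψ p) (hm p)).2
  let g' : U.toScheme.functionField := functionFieldMap ψ hψ g
  have hg' : g' ≠ 0 := (map_ne_zero (functionFieldMap ψ hψ).hom).2 hg
  refine ⟨pushforward U.ι (divisor U g'), AddSubgroup.subset_closure
    ⟨U, hU, inferInstance, U.ι, hp, g', hdvr, hg', rfl⟩, ?_, ?_⟩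
  · intro p hp hpZ
    obtain ⟨p, rfl⟩ : ∃ q : U.toScheme, U.ι q = p := ⟨⟨p, hpZ⟩, rfl⟩
    have hpU : p ∈ closedPoints U.toScheme := by
      have : {p} = U.ι ⁻¹' {U.ι p} := by
        ext q
        exact U.ι.isEmbedding.injective.eq_iff.symm
      rw [mem_closedPoints_iff, this]
      exact (mem_closedPoints_iff.1 hp).preimage U.ι.continuous
    have h1 := hC _ (hcl p hpU)
    have h2 := hdvr p hpU
    rw [mult_pushforward_apply, mult_divisor hdvr hg' hpU]
    exact ord_functionFieldMap ψ hψ p (hm p) g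
  · intro p hp
    refine mult_pushforward_of_notMem_range U.ι _ ?_
    rintro ⟨q, rfl⟩
    exact hp q.2

lemma flatPullback_divisor_mem [LocallyOfFiniteType s] (H : IsPullback ρ t s φ)
    (hC : ∀ P ∈ closedPoints C, IsDiscreteValuationRing (C.presheaf.stalk P))
    {g : C.functionField} (hg : g ≠ 0) :
    (flatPullback ρ (divisor C g)).zeroDim ∈ rationallyTrivial D := by
  classical
  have hρ : IsFinite ρ := MorphismProperty.of_isPullback H.flip (inferInstance : IsFinite φ)
  have hDn : IsNoetherian D :=
    have : IsLocallyNoetherian D := LocallyOfFiniteType.isLocallyNoetherian ρ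
    have : CompactSpace D := QuasiCompact.compactSpace_of_compactSpace ρ
    ⟨⟩
  have hD := isDomain_stalk_of_isPullback H hC
  choose! b hb hb1 hb2 using fun Z (hZ : Z ∈ irreducibleComponents D) =>
    exists_rationallyTrivial_of_component H hC hg hZ
  have hfin : (irreducibleComponents D).Finite := NoetherianSpace.finite_irreducibleComponents
  have heq : (flatPullback ρ (divisor C g)).zeroDim = ∑ Z ∈ hfin.toFinset, b Z := by
    refine ext_mult fun p => ?_
    by_cases hp : p ∈ closedPoints D
    · have hρp : ρ p ∈ closedPoints C := (imageClosedPoint ρ ⟨p, hp⟩).2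
      have hZp : irreducibleComponent p ∈ irreducibleComponents D :=
        irreducibleComponent_mem_irreducibleComponents p
      rw [mult_zeroDim_flatPullback H, mult_divisor hC hg hρp, mult_sum,
        Finset.sum_eq_single (irreducibleComponent p)]
      · exact (hb1 _ hZp p hp mem_irreducibleComponent).symm
      · intro Z hZ hne
        rw [Set.Finite.mem_toFinset] at hZ
        refine hb2 Z hZ p fun hpZ => hne ?_
        have := hD p
        exact eq_of_mem_irreducibleComponents p hZ hZp hpZ mem_irreducibleComponent
      · intro h
        exact absurd (hfin.mem_toFinset.2 hZp) h
    · rw [mult_of_notMem _ hp, mult_of_notMem _ hp]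
  rw [heq]
  exact AddSubgroup.sum_mem _ fun Z hZ => hb Z (hfin.mem_toFinset.1 hZ)

end FiniteExtension

/-- Pullback of 0-cycles along a finite extension of the base field preserves rational
equivalence. -/
lemma flatPullback_mem_rationallyTrivial {k L : Type u} [Field k] [CharZero k] [Field L]
    {X X' : Scheme.{u}} {π : X' ⟶ X}
    {t : X' ⟶ Spec (.of L)} {s : X ⟶ Spec (.of k)} {φ : Spec (.of L) ⟶ Spec (.of k)} [IsFinite φ]
    [LocallyOfFiniteType s] [QuasiCompact s]
    (H : IsPullback π t s φ) {a : Z0 X} (ha : a ∈ rationallyTrivial X) :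
    (flatPullback π a).zeroDim ∈ rationallyTrivial X' := by
  induction ha using AddSubgroup.closure_induction with
  | zero =>
    rw [map_zero]
    exact zero_mem _
  | add a b _ _ ha hb =>
    rw [map_add, zeroDim_add]
    exact add_mem ha hb
  | neg a _ ha =>
    rw [map_neg, zeroDim_neg]
    exact neg_mem ha
  | mem a ha =>
    obtain ⟨C, hC, hC', f, hf, g, hs, hg, rfl⟩ := ha
    have H' := IsPullback.of_hasPullback f π
    have hCn : IsNoetherian C :=
      have : CompactSpace C := QuasiCompact.compactSpace_of_compactSpace (f ≫ s)
      ⟨⟩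
    have H₂ : IsPullback (pullback.fst f π) (pullback.snd f π ≫ t) (f ≫ s) φ :=
      (H'.flip.paste_horiz H.flip).flip
    rw [flatPullback_pushforward H H']
    exact pushforward_mem_rationallyTrivial _ (flatPullback_divisor_mem H₂ hs hg)

end

/-! ### Exterior products -/

lemma classMod_eq_iff {V : Scheme.{u}} {n : ℕ} {a b : Z0 V} :
    classMod n a = classMod n b ↔ ∃ e : Z0 V, ∃ r ∈ rationallyTrivial V, b = a + n • e + r := by
  rw [classMod, classMod, QuotientAddGroup.eq]
  constructor
  · rintro ⟨e, he⟩
    obtain ⟨e, rfl⟩ := QuotientAddGroup.mk_surjective e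
    have h : ((n • e : Z0 V) : CH0 V) = ((-a + b : Z0 V) : CH0 V) := he
    rw [QuotientAddGroup.eq] at h
    exact ⟨e, _, h, by abel⟩
  · rintro ⟨e, r, hr, rfl⟩
    refine ⟨(e : CH0 V), ?_⟩
    have h : ((n • e : Z0 V) : CH0 V) = ((-a + (a + n • e + r) : Z0 V) : CH0 V) := by
      rw [QuotientAddGroup.eq]
      convert hr using 1
      abel
    exact h

section ExteriorProduct

variable {K : Type u} [Field K] {W X Y : Scheme.{u}} {q₁ : W ⟶ X} {q₂ : W ⟶ Y}
  {f : X ⟶ Spec (.of K)} {g : Y ⟶ Spec (.of K)}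

/-- A rational point of a product is the only point over its pair of projections: the fibre of `q₁`
over a rational point maps isomorphically to `Y`. -/
lemma eq_of_map_eq_of_section (H : IsPullback q₁ q₂ f g) {σ : Spec (.of K) ⟶ W}
    (hσ : σ ≫ q₁ ≫ f = 𝟙 _) (u : Spec (.of K)) {w : W} (h1 : q₁ w = q₁ (σ u))
    (h2 : q₂ w = q₂ (σ u)) : w = σ u := by
  have h : IsPullback (pullback.fst q₁ (σ ≫ q₁) ≫ q₂) (pullback.snd q₁ (σ ≫ q₁)) g
      ((σ ≫ q₁) ≫ f) := (IsPullback.of_hasPullback q₁ (σ ≫ q₁)).paste_horiz H.flip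
  rw [Category.assoc, hσ] at h
  have hiso : IsIso (pullback.fst q₁ (σ ≫ q₁) ≫ q₂) := h.isIso_fst_of_isIso
  obtain ⟨a, ha, -⟩ := Scheme.Pullback.exists_preimage_pullback (f := q₁) (g := σ ≫ q₁) w u h1
  obtain ⟨b, hb, -⟩ := Scheme.Pullback.exists_preimage_pullback (f := q₁) (g := σ ≫ q₁) (σ u) u rfl
  have : a = b := by
    refine (pullback.fst q₁ (σ ≫ q₁) ≫ q₂).isOpenEmbedding.injective ?_
    change q₂ (pullback.fst q₁ (σ ≫ q₁) a) = q₂ (pullback.fst q₁ (σ ≫ q₁) b)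
    rw [ha, hb, h2]
  rw [← ha, ← hb, this]

lemma residueDegree_eq_one_of_section {q : W ⟶ X} {σ : Spec (.of K) ⟶ W}
    (hσ : σ ≫ q ≫ f = 𝟙 _) (u : Spec (.of K)) : q.residueDegree (σ u) = 1 := by
  have h1 := residueDegree_comp σ (q ≫ f) u
  have h2 : (σ ≫ q ≫ f).residueDegree u = 1 := by
    rw [hσ, Scheme.Hom.residueDegree_id]
  rw [h2, residueDegree_comp] at h1
  exact Nat.eq_one_of_mul_eq_one_left (Nat.eq_one_of_mul_eq_one_right h1.symm)

variable [CharZero K] [IsProper f] [IsProper g]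

/-- Existence of the exterior product `a × b`, and its compatibility with rational equivalence in
the first variable. For a single point `b = Q` it is the pushforward from `X_{κ(Q)}`, the fibre of
`q₂` over `Q`, of the pullback of `a`. -/
lemma exists_exteriorProduct (H : IsPullback q₁ q₂ f g) (a : Z0 X) (b : Z0 Y) :
    ∃ c : Z0 W, (∀ w, mult c w = mult a (q₁ w) * mult b (q₂ w)) ∧
      (a ∈ rationallyTrivial X → c ∈ rationallyTrivial W) := by
  induction b using Finsupp.induction_linear with
  | zero => exact ⟨0, by simp, fun _ => zero_mem _⟩
  | add b₁ b₂ h₁ h₂ =>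
    obtain ⟨c₁, hc₁, hr₁⟩ := h₁
    obtain ⟨c₂, hc₂, hr₂⟩ := h₂
    exact ⟨c₁ + c₂, fun w => by rw [mult_add, mult_add, hc₁, hc₂, mul_add],
      fun ha => add_mem (hr₁ ha) (hr₂ ha)⟩
  | single Q n =>
    have hφ : IsFinite (Y.fromSpecResidueField Q.1 ≫ g) :=
      isFinite_fromSpecResidueField_comp g Q.2
    have H' := isPullback_fiber H.flip Q.1
    have hi : IsProper (q₂.fiberι Q.1) := by
      have h := isClosed_singleton_iff_isClosedImmersion.1 (mem_closedPoints_iff.1 Q.2)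
      have h1 : IsPullback (q₂.fiberι Q.1) (q₂.fiberToSpecResidueField Q.1) q₂
        (Y.fromSpecResidueField Q.1) := IsPullback.of_hasPullback _ _
      exact MorphismProperty.of_isPullback h1.flip
        (inferInstance : IsProper (Y.fromSpecResidueField Q.1))
    let d : Z0 (q₂.fiber Q.1) := (flatPullback (q₂.fiberι Q.1 ≫ q₁) a).zeroDim
    have hd (p : q₂.fiber Q.1) : mult d p = mult a (q₁ (q₂.fiberι Q.1 p)) :=
      mult_zeroDim_flatPullback (K := Y.residueField Q.1) H' a p
    refine ⟨n • pushforward (q₂.fiberι Q.1) d, fun w => ?_, fun ha => ?_⟩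
    · rw [mult_zsmul]
      by_cases hw : q₂ w = Q.1
      · obtain ⟨p, rfl⟩ := exists_fiberι_apply_eq q₂ hw
        rw [mult_pushforward_apply, hd, mult_single_eq _ _ _ hw, mul_comm]
      · rw [mult_single_of_ne _ _ _ hw, mul_zero, mult_pushforward_of_notMem_range, mul_zero]
        rintro ⟨p, rfl⟩
        exact hw (map_fiberι_apply q₂ _ p)
    · refine AddSubgroup.zsmul_mem _ (pushforward_mem_rationallyTrivial _ ?_) n
      exact flatPullback_mem_rationallyTrivial (L := Y.residueField Q.1) H' ha

/-- An exterior product `c = a × b` whose factors agree with the projections of a rational point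
agrees with that point. -/
lemma classMod_exteriorProduct_eq (H : IsPullback q₁ q₂ f g) [IsProper q₁] [IsProper q₂] {n : ℕ}
    {a : Z0 X} {b : Z0 Y} {c z : Z0 W}
    (hc : ∀ w, mult c w = mult a (q₁ w) * mult b (q₂ w))
    (ha : classMod n a = classMod n (pushforward q₁ z))
    (hb : classMod n b = classMod n (pushforward q₂ z))
    (hz : IsClassOfRationalPoint K (q₁ ≫ f) z) : classMod n c = classMod n z := by
  obtain ⟨σ, R, hσ, ⟨u, hu⟩, hR⟩ := hz
  have hσ' : σ ≫ q₂ ≫ g = 𝟙 _ := by rw [← H.w, hσ]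
  have hpush {V : Scheme.{u}} (q : W ⟶ V) [IsProper q] (hq : q.residueDegree (σ u) = 1) :
      classMod n (pushforward q z) = classMod n (Finsupp.single (imageClosedPoint q R) 1) := by
    have h1 : pushforward q (Finsupp.single R 1) = Finsupp.single (imageClosedPoint q R) 1 := by
      rw [pushforward_single, ← hu, hq, Nat.cast_one, mul_one]
    rw [← h1]
    rw [QuotientAddGroup.eq] at hR
    refine classMod_eq_iff.2 ⟨0, _, pushforward_mem_rationallyTrivial q hR, ?_⟩
    rw [map_add, map_neg]
    simp
  rw [hpush q₁ (residueDegree_eq_one_of_section hσ u)] at ha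
  rw [hpush q₂ (residueDegree_eq_one_of_section hσ' u)] at hb
  have hz' : classMod n z = classMod n (Finsupp.single R 1) :=
    congrArg QuotientAddGroup.mk hR
  rw [hz']
  obtain ⟨e₁, r₁, hr₁, h₁⟩ := classMod_eq_iff.1 ha
  obtain ⟨e₂, r₂, hr₂, h₂⟩ := classMod_eq_iff.1 hb
  -- Write `P` and `Q` for the projections of `R`, so that `P = a + n e₁ + r₁` and
  -- `Q = b + n e₂ + r₂`; then `P × Q = a × b + (n e₁ + r₁) × b + P × (n e₂ + r₂)`.
  obtain ⟨d₁, hd₁, -⟩ := exists_exteriorProduct H e₁ b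
  obtain ⟨s₁, hs₁, hs₁'⟩ := exists_exteriorProduct H r₁ b
  obtain ⟨d₂, hd₂, -⟩ := exists_exteriorProduct H.flip e₂ (Finsupp.single (imageClosedPoint q₁ R) 1)
  obtain ⟨s₂, hs₂, hs₂'⟩ := exists_exteriorProduct H.flip r₂
    (Finsupp.single (imageClosedPoint q₁ R) 1)
  refine classMod_eq_iff.2 ⟨d₁ + d₂, s₁ + s₂, add_mem (hs₁' hr₁) (hs₂' hr₂), ext_mult fun w => ?_⟩
  have hPQ : mult (Finsupp.single R 1) w = mult (Finsupp.single (imageClosedPoint q₁ R) 1) (q₁ w) *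
      mult (Finsupp.single (imageClosedPoint q₂ R) 1) (q₂ w) := by
    by_cases h1 : q₁ w = q₁ R.1
    · by_cases h2 : q₂ w = q₂ R.1
      · rw [mult_single_eq (imageClosedPoint q₁ R) 1 _ h1,
          mult_single_eq (imageClosedPoint q₂ R) 1 _ h2, mul_one]
        rw [← hu] at h1 h2
        exact mult_single_eq _ _ _ ((eq_of_map_eq_of_section H hσ u h1 h2).trans hu)
      · rw [mult_single_of_ne (imageClosedPoint q₂ R) 1 _ h2, mul_zero]
        exact mult_single_of_ne _ _ _ fun h => h2 (by rw [h])
    · rw [mult_single_of_ne (imageClosedPoint q₁ R) 1 _ h1, zero_mul]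
      exact mult_single_of_ne _ _ _ fun h => h1 (by rw [h])
  rw [hPQ]
  simp only [mult_add, mult_nsmul, hc, hd₁, hs₁, hd₂, hs₂]
  have h₁' := congrArg (fun a => mult a (q₁ w)) h₁
  have h₂' := congrArg (fun a => mult a (q₂ w)) h₂
  simp only [mult_add, mult_nsmul] at h₁' h₂'
  rw [h₂', mul_add, mul_add, h₁']
  ring

end ExteriorProduct

lemma mult_zeroDim_intersect {k : Type u} [Field k] [CharZero k] {W X Y : Scheme.{u}} {q₁ : W ⟶ X}
    {q₂ : W ⟶ Y} {f : X ⟶ Spec (.of k)} {g : Y ⟶ Spec (.of k)} (H : IsPullback q₁ q₂ f g)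
    [LocallyOfFiniteType f] [∀ x, IsIntegral (q₁.fiber x)] [∀ y, IsIntegral (q₂.fiber y)]
    (a : Z0 X) (b : Z0 Y) (w : W) :
    mult (intersect (flatPullback q₁ a) (flatPullback q₂ b)).zeroDim w =
      mult a (q₁ w) * mult b (q₂ w) := by
  by_cases hw : w ∈ closedPoints W
  · rw [mult_zeroDim _ hw, intersect_flatPullback_apply H]
  · rw [mult_of_notMem _ hw]
    by_cases h1 : q₁ w ∈ closedPoints X
    · by_cases h2 : q₂ w ∈ closedPoints Y
      · have := isFinite_fromSpecResidueField_comp f h1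
        exact absurd (mem_closedPoints_of_isPullback H h1 h2) hw
      · rw [mult_of_notMem _ h2, mul_zero]
    · rw [mult_of_notMem _ h1, zero_mul]

lemma isPullback_extMap {k : Type u} [Field k] (K : Type u) [Field K] [Algebra k K]
    {V W : Scheme.{u}} (t : W ⟶ Spec (.of k)) (f : V ⟶ W) :
    IsPullback (extMap K (f ≫ t) t f rfl)
      (pullback.fst (f ≫ t) (Spec.map (CommRingCat.ofHom (algebraMap k K))))
      (pullback.fst t (Spec.map (CommRingCat.ofHom (algebraMap k K)))) f := by
  refine IsPullback.of_right (h₁₂ := pullback.snd _ _) (h₂₂ := t)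
    (v₁₃ := Spec.map (CommRingCat.ofHom (algebraMap k K))) ?_ ?_ ?_
  · have e : extMap K (f ≫ t) t f rfl ≫ pullback.snd _ _ = pullback.snd _ _ := by
      rw [extMap, pullback.map, pullback.lift_snd, Category.comp_id]
    rw [e]
    exact (IsPullback.of_hasPullback (f ≫ t)
      (Spec.map (CommRingCat.ofHom (algebraMap k K)))).flip
  · rw [extMap, pullback.map, pullback.lift_fst]
  · exact (IsPullback.of_hasPullback t (Spec.map (CommRingCat.ofHom (algebraMap k K)))).flip

/-- Extension of the base field commutes with products. -/
lemma isPullback_extMap_extMap {k : Type u} [Field k] (K : Type u) [Field K] [Algebra k K]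
    {W X Y : Scheme.{u}} {q₁ : W ⟶ X} {q₂ : W ⟶ Y} {f : X ⟶ Spec (.of k)} {g : Y ⟶ Spec (.of k)}
    (H : IsPullback q₁ q₂ f g) :
    IsPullback (extMap K (q₁ ≫ f) f q₁ rfl) (extMap K (q₁ ≫ f) g q₂ H.w.symm) (extStr K f)
      (extStr K g) := by
  have h1 := (isPullback_extMap K f q₁).flip.paste_horiz H.flip
  have h2 : extMap K (q₁ ≫ f) g q₂ H.w.symm ≫ pullback.fst g _ = pullback.fst _ _ ≫ q₂ := by
    rw [extMap, pullback.map, pullback.lift_fst]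
  have h3 : extMap K (q₁ ≫ f) g q₂ H.w.symm ≫ extStr K g = extStr K _ := by
    rw [extMap, pullback.map, extStr, pullback.lift_snd, Category.comp_id]
  have h4 : extMap K (q₁ ≫ f) f q₁ rfl ≫ extStr K f = extStr K _ := by
    rw [extMap, pullback.map, extStr, pullback.lift_snd, Category.comp_id]
  rw [← h2, pullback.condition] at h1
  exact (IsPullback.of_right h1 (h3.trans h4.symm) (IsPullback.of_hasPullback g _)).flip

end ZeroCycles

end

open ZeroCycles
theorem lemma4p9 {k : Type u} [Field k] [NumberField k] {X Y : Scheme.{u}}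
    (f : X ⟶ Spec (.of k)) [IsProper f] [Smooth f] [GeometricallyIntegral f]
    (g : Y ⟶ Spec (.of k)) [IsProper g] [Smooth g] [GeometricallyIntegral g]
    (S : Finset (Place k)) (n : ℕ) (hn : 0 < n)
    (x : Z0 X) (y : Z0 Y)
    (z : ∀ v : Place k, Z0 (ext v.Completion (pullback.fst f g ≫ f)))
    (hdeg : ∀ v ∈ S, degree (extStr v.Completion (pullback.fst f g ≫ f)) (z v) = 1)
    (hx : ∀ v ∈ S, classMod n (extCycle v.Completion f x) =
      classMod n (pushforward
        (extMap v.Completion (pullback.fst f g ≫ f) f (pullback.fst f g) rfl) (z v)))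
    (hy : ∀ v ∈ S, classMod n (extCycle v.Completion g y) =
      classMod n (pushforward
        (extMap v.Completion (pullback.fst f g ≫ f) g (pullback.snd f g)
          pullback.condition.symm) (z v)))
    (hz : ∀ v ∈ S, IsClassOfRationalPoint v.Completion
      (extStr v.Completion (pullback.fst f g ≫ f)) (z v)) :
    MeetProperly (flatPullback (pullback.fst f g) x) (flatPullback (pullback.snd f g) y) ∧
    ∀ v ∈ S, classMod n (extCycle v.Completion (pullback.fst f g ≫ f)
        (intersect (flatPullback (pullback.fst f g) x)
          (flatPullback (pullback.snd f g) y)).zeroDim) =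
      classMod n (z v) := by
  have H := IsPullback.of_hasPullback f g
  refine ⟨meetProperly_flatPullback H x y, fun v hv => ?_⟩
  have hK : CharZero v.Completion :=
    charZero_of_injective_algebraMap (algebraMap k v.Completion).injective
  have HK := isPullback_extMap_extMap v.Completion H
  refine classMod_exteriorProduct_eq HK (fun w => ?_) (hx v hv) (hy v hv) ?_
  · rw [mult_extCycle, mult_zeroDim_intersect H, mult_extCycle, mult_extCycle]
    have h1 : extMap v.Completion (pullback.fst f g ≫ f) f (pullback.fst f g) rfl ≫
        pullback.fst f _ = pullback.fst _ _ ≫ pullback.fst f g := by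
      rw [extMap, pullback.map, pullback.lift_fst]
    have h2 : extMap v.Completion (pullback.fst f g ≫ f) g (pullback.snd f g)
        pullback.condition.symm ≫ pullback.fst g _ = pullback.fst _ _ ≫ pullback.snd f g := by
      rw [extMap, pullback.map, pullback.lift_fst]
    have h1' := congr($h1 w)
    have h2' := congr($h2 w)
    rw [Scheme.Hom.comp_apply, Scheme.Hom.comp_apply] at h1' h2'
    rw [h1', h2']
  · have h4 : extMap v.Completion (pullback.fst f g ≫ f) f (pullback.fst f g) rfl ≫
        extStr v.Completion f = extStr v.Completion (pullback.fst f g ≫ f) := by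
      rw [extMap, pullback.map, extStr, pullback.lift_snd, Category.comp_id]
    rw [h4]
    exact hz v hv
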